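/- Let $\mathcal W=\mathbb R^d$ with the Euclidean norm $\|\cdot\|=\|\cdot\|_2$ (which is its own dual norm), let $\mathcal X\subset\mathbb R^d$ be bounded, $R=\sup_{x\in\mathcal X}\|x\|$, let $\mathcal Y\subset\mathbb R$, and let $\rho$ be a Borel probability measure on $\mathcal Z=\mathcal X\times\mathcal Y$. Let $\phi:\mathbb R\times\mathbb R\to[0,\infty)$ be measurable, convex and differentiable in its first variable with partial derivative $\phi'$, and $$\ell_\phi=\sup_{u\neq v\in\mathbb R,\ y\in\mathcal Y}\frac{|\phi'(u,y)-\phi'(v,y)|}{|u-v|}<\infty .$$ Let $\lambda>0$, $f(w,z)=\phi(\langle w,x\rangle,y)+\lambda\|w\|_2^2$ for $z=(x,y)$, and $F(w)=\mathbb E_Z[f(w,Z)]$ with $Z\sim\rho$, where $f(w,Z)$ is assumed integrable for every $w$. Put $L=2(\ell_\phi R^2+\lambda)$. For a differentiable $g:\mathcal W\to\mathbb R$ let $D_g(v,w)=g(v)-g(w)-\langle v-w,\nabla g(w)\rangle$; $g$ is $c$-strongly smooth if $D_g(v,w)\le\frac c2\|v-w\|^2$ for all $v,w$, and $c$-strongly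 convex if $D_g(v,w)\ge\frac c2\|v-w\|^2$ for all $v,w$. **Then** $f(\cdot,z)$ is $L$-strongly smooth for every $z\in\mathcal Z$, $F$ is $L$-strongly smooth, and $F$ is $2\lambda$-strongly convex. Let further $w^*$ be a minimizer of $F$, and let $\Psi:\mathcal W\to\mathbb R$ be either a $p$-norm divergence $\Psi_p(w)=\frac12\|w\|_p^2$, $1<p\le2$, or a strongly smooth mirror map, that is, Fréchet differentiable, $\sigma$-strongly convex for some $\sigma>0$ and $L'$-strongly smooth for some $L'>0$. (In both cases $\Psi$ is differentiable and strongly convex with some positive constant.) Let $z_1,z_2,\dots$ be independent with law $\rho$, let $\eta_t>0$ for $t\ge1$, and let $w_1\in\mathcal W$ be a fixed vector and $$\nabla\Psi(w_{t+1})=\nabla\Psi(w_t)-\eta_t\nabla_w[f(w_t,z_t)],\qquad t=1,2,\dots$$ Then $\mathbb E\|w^*-w_t\|^2<\infty$ for all $t\geq 1$, and the following hold. (a) Assume $\inf_{w\in\mathcal W}\mathbb E_Z\|\nabla_w[f(w,Z)]\|>0$. Then $\lim_{t\to\infty}\mathbb E\|w^*-w_t\|^2=0$ if and only if $\lim_{t\to\infty}\eta_t=0$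 and $\sum_{t=1}^\infty\eta_t=\infty$. Furthermore, let $\Psi$ be $L_\Psi$-strongly smooth, $L_\Psi>0$. If $\lim_{t\to\infty}\eta_t=0$, then there are $T_1\in\mathbb N$ and $C>0$ with $\mathbb E\|w^*-w_T\|^2\ge CT^{-1}$ for all $T\ge T_1$. If $\eta_t=\frac{4}{(t+1)\sigma}$ for all $t\ge 1$ with $\sigma=4\lambda/L_\Psi$, then $\mathbb E\|w^*-w_T\|^2=O(T^{-1})$. (b) Assume $w_1\ne w^*$ and $\mathbb E_Z\|\nabla_w[f(w^*,Z)]\|=0$, and let $\Psi$ be $\sigma_\Psi$-strongly convex, $\sigma_\Psi>0$. If for some $\kappa>0$ we have $\eta_t\le\frac{\sigma_\Psi}{(2+\kappa)L}$ for all $t\ge1$, then $\lim_{t\to\infty}\mathbb E\|w^*-w_t\|^2=0$ if and only if $\sum_{t=1}^\infty\eta_t=\infty$. Furthermore, if $\Psi$ is $L_\Psi$-strongly smooth, $L_\Psi>0$, and $\eta_t=\eta_1<\frac{\sigma_\Psi}{2L}$ for all $t\ge1$, then there are $c_1,c_2\in(0,1)$ such that for every integer $T\ge0$ $$c_1^T\|w^*-w_1\|^2\le\mathbb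 E\|w^*-w_{T+1}\|^2\le\frac{L_\Psi}{\sigma_\Psi}\,c_2^T\|w^*-w_1\|^2 .$$ (c) If $\sum_{t=1}^\infty\eta_t=\infty$ and $\sum_{t=1}^\infty\eta_t^2<\infty$, then $\|w^*-w_t\|^2\to0$ almost surely. -/

import Mathlib

open Filter Topology MeasureTheory ProbabilityTheory Asymptotics

noncomputable section

namespace OMD

/-- The space `𝒲 = ℝ^d` with the Euclidean norm `‖·‖₂`; its dual norm is again `‖·‖₂`, and the
dual space is identified with `ℝ^d` through the Euclidean inner product. -/
abbrev W (d : ℕ) : Type := EuclideanSpace ℝ (Fin d)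

/-- Bregman distance `D_g(v, w) = g v - g w - ⟨v - w, ∇g(w)⟩`. -/
def bregman {d : ℕ} (g : W d → ℝ) (v w : W d) : ℝ :=
  g v - g w - inner ℝ (v - w) (gradient g w)

/-- `g` is Fréchet differentiable and `σ`-strongly convex with respect to `‖·‖₂`. -/
def StronglyConvexWith {d : ℕ} (g : W d → ℝ) (σ : ℝ) : Prop :=
  Differentiable ℝ g ∧ ∀ v w : W d, σ / 2 * ‖v - w‖ ^ 2 ≤ bregman g v w

/-- `g` is Fréchet differentiable and `L`-strongly smooth with respect to `‖·‖₂`. -/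
def StronglySmoothWith {d : ℕ} (g : W d → ℝ) (L : ℝ) : Prop :=
  Differentiable ℝ g ∧ ∀ v w : W d, bregman g v w ≤ L / 2 * ‖v - w‖ ^ 2

/-- The `p`-norm divergence `Ψ_p(w) = ‖w‖_p² / 2`, where `‖w‖_p = (∑ᵢ |w(i)|^p)^(1/p)`. -/
def pNormDivergence {d : ℕ} (p : ℝ) (w : W d) : ℝ :=
  1 / 2 * ((∑ i : Fin d, |w i| ^ p) ^ (1 / p)) ^ 2

/-- `Ψ` is a `p`-norm divergence with `1 < p ≤ 2`, or a strongly smooth mirror map (a mirror map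
being Fréchet differentiable and strongly convex). -/
def AdmissibleMirrorMap {d : ℕ} (Ψ : W d → ℝ) : Prop :=
  (∃ p : ℝ, 1 < p ∧ p ≤ 2 ∧ Ψ = pNormDivergence p) ∨
  ((∃ σ : ℝ, 0 < σ ∧ StronglyConvexWith Ψ σ) ∧ ∃ L : ℝ, 0 < L ∧ StronglySmoothWith Ψ L)

/-- The partial derivative `φ'(u, y)` of the loss in its first variable. -/
def lossDeriv (φ : ℝ → ℝ → ℝ) (u y : ℝ) : ℝ := deriv (fun a => φ a y) u

/-- The set of quotients `|φ'(u, y) - φ'(v, y)| / |u - v|`, `u ≠ v`, `y ∈ 𝒴`. -/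
def lipQuotients (φ : ℝ → ℝ → ℝ) (𝒴 : Set ℝ) : Set ℝ :=
  {q | ∃ u v y : ℝ, u ≠ v ∧ y ∈ 𝒴 ∧ q = |lossDeriv φ u y - lossDeriv φ v y| / |u - v|}

/-- `ℓ_φ`, the supremum of the above quotients. -/
def lipConst (φ : ℝ → ℝ → ℝ) (𝒴 : Set ℝ) : ℝ := sSup (lipQuotients φ 𝒴)

/-- `R = sup_{x ∈ 𝒳} ‖x‖₂`. -/
def radius {d : ℕ} (𝒳 : Set (W d)) : ℝ := sSup ((fun x => ‖x‖) '' 𝒳)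

/-- The constant `2 (ℓ_φ R² + λ)`. -/
def smoothConst {d : ℕ} (𝒳 : Set (W d)) (𝒴 : Set ℝ) (φ : ℝ → ℝ → ℝ) (lam : ℝ) : ℝ :=
  2 * (lipConst φ 𝒴 * radius 𝒳 ^ 2 + lam)

/-- The regularized loss `f(w, (x, y)) = φ(⟨w, x⟩, y) + λ ‖w‖₂²`. -/
def regLoss {d : ℕ} {𝒳 : Set (W d)} {𝒴 : Set ℝ} (φ : ℝ → ℝ → ℝ) (lam : ℝ)
    (w : W d) (s : 𝒳 × 𝒴) : ℝ :=
  φ (inner ℝ w (s.1 : W d)) (s.2 : ℝ) + lam * ‖w‖ ^ 2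

/-- The gradient `∇_w [f(w, s)]` of the regularized loss in `w`. -/
def regLossGrad {d : ℕ} {𝒳 : Set (W d)} {𝒴 : Set ℝ} (φ : ℝ → ℝ → ℝ) (lam : ℝ)
    (w : W d) (s : 𝒳 × 𝒴) : W d :=
  gradient (fun v => regLoss φ lam v s) w

/-- The regularized risk `F(w) = 𝔼_Z [f(w, Z)]`. -/
def risk {d : ℕ} {𝒳 : Set (W d)} {𝒴 : Set ℝ} (ρ : Measure (𝒳 × 𝒴)) (φ : ℝ → ℝ → ℝ)
    (lam : ℝ) (w : W d) : ℝ :=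
  ∫ s, regLoss φ lam w s ∂ρ

/-- `𝔼_Z ‖∇_w [f(w, Z)]‖`. -/
def meanGradNorm {d : ℕ} {𝒳 : Set (W d)} {𝒴 : Set ℝ} (ρ : Measure (𝒳 × 𝒴))
    (φ : ℝ → ℝ → ℝ) (lam : ℝ) (w : W d) : ℝ :=
  ∫ s, ‖regLossGrad φ lam w s‖ ∂ρ

/-- `z₁, z₂, …` are independent samples of law `ρ`. Time starts at `1`; `z 0` plays no role. -/
def IsSample {d : ℕ} {𝒳 : Set (W d)} {𝒴 : Set ℝ} (ρ : Measure (𝒳 × 𝒴)) {Ω : Type*}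
    [MeasurableSpace Ω] (P : Measure Ω) (z : ℕ → Ω → 𝒳 × 𝒴) : Prop :=
  (∀ t, 1 ≤ t → Measurable (z t) ∧ P.map (z t) = ρ) ∧ iIndepFun (fun t : ℕ => z (t + 1)) P

/-- `w₁, w₂, …` are the iterates of online mirror descent started at the vector `w₁`:
`∇Ψ(w_{t+1}) = ∇Ψ(w_t) - η_t ∇_w [f(w_t, z_t)]` for `t ≥ 1`. The term `w 0` plays no role. -/
def IsOMD {d : ℕ} {𝒳 : Set (W d)} {𝒴 : Set ℝ} (φ : ℝ → ℝ → ℝ) (lam : ℝ) (Ψ : W d → ℝ)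
    (η : ℕ → ℝ) {Ω : Type*} (z : ℕ → Ω → 𝒳 × 𝒴) (w₁ : W d) (w : ℕ → Ω → W d) : Prop :=
  (∀ ω, w 1 ω = w₁) ∧
  ∀ t, 1 ≤ t → ∀ ω, gradient Ψ (w (t + 1) ω) =
    gradient Ψ (w t ω) - η t • regLossGrad φ lam (w t ω) (z t ω)

/-- `𝔼 ‖w* - w_t‖²`. -/
def meanSqError {d : ℕ} {Ω : Type*} [MeasurableSpace Ω] (P : Measure Ω) (wstar : W d)
    (w : ℕ → Ω → W d) (t : ℕ) : ℝ :=
  ∫ ω, ‖wstar - w t ω‖ ^ 2 ∂P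

/-- `∑_{t ≥ 1} η_t = ∞`. -/
def SumDiverges (η : ℕ → ℝ) : Prop :=
  Tendsto (fun n : ℕ => ∑ t ∈ Finset.Icc 1 n, η t) atTop atTop

end OMD

end

/-! The whole argument follows the Bregman distance D_n = D_Ψ(w*, w_n). The three-point identity
turns the mirror step into D_{n+1} = D_n + D_Ψ(w_n, w_{n+1}) - η_n ⟨w_n - w*, ∇f(w_n, z_n)⟩. Split
the gradient into its value at w* and the difference from that value. The value at w* is independent
of w_n and has mean zero, so its contribution vanishes in expectation. By strong convexity and
smoothness of f(·, z), the inner product with the difference lies between 2λ‖w_n - w*‖² and L‖w_n -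
w*‖². The cost D_Ψ(w_n, w_{n+1}) is of order η_n²‖∇f(w_n, z_n)‖²: from above because Ψ is strongly
convex, from below when Ψ is strongly smooth. This gives scalar recursions for 𝔼 D_n in both
directions (`meanBregman_succ_le`, `le_meanBregman_succ_add`).

From above, the drift beats the noise term of order η_n² when η_n → 0, and non-summable steps then
bring 𝔼 D_n to zero. From below, 𝔼 D_{n+1} ≥ (1 - 2Lη_n/σ) 𝔼 D_n, so summable steps cannot do so. If
mean gradient norms are bounded below and Ψ is smooth, an additional term of order η_n² forces the
rate 1/T. That η_n → 0 is necessary holds because η_n‖∇f(w_n, z_n)‖ is the displacement of ∇Ψ, and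
∇Ψ is continuous at w*. In (b) the noise is absent and cocoercivity lets the drift pay for the step.
In (c), D_n minus an accumulated noise budget is a supermartingale, and Fatou's lemma identifies its
limit.

A p-norm divergence need not be strongly smooth, so D_Ψ(w*, w) may fail to be bounded by a multiple
of ‖w* - w‖². The substitute is D_Ψ(w*, w) ≤ δ + C_δ‖w* - w‖² for every δ > 0
(`QuadraticallyBounded.exists_bregman_le`), which needs only convexity, differentiability and
quadratic growth. `tendsto_zero_of_recursion` is shaped to use this weaker comparison. -/

noncomputable section

namespace OMD

/-! ### Bregman distances, smoothness and strong convexity -/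

section Bregman

variable {d : ℕ} {g : W d → ℝ}

lemma bregman_add_bregman_swap (g : W d → ℝ) (v w : W d) :
    bregman g v w + bregman g w v = inner ℝ (v - w) (gradient g v - gradient g w) := by
  simp only [bregman, inner_sub_left, inner_sub_right]
  ring

lemma bregman_three_point (g : W d → ℝ) (u v w : W d) :
    bregman g u w = bregman g u v + bregman g v w
      + inner ℝ (u - v) (gradient g v - gradient g w) := by
  simp only [bregman, inner_sub_left, inner_sub_right]
  ring

lemma StronglyConvexWith.bregman_nonneg {σ : ℝ} (hσ : 0 ≤ σ) (hg : StronglyConvexWith g σ)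
    (v w : W d) : 0 ≤ bregman g v w :=
  le_trans (by positivity) (hg.2 v w)

/-- Smooth functions with nonnegative Bregman distance (that is, convex ones) have a Bregman
distance bounded below by the squared distance of the gradients. -/
lemma StronglySmoothWith.norm_sq_gradient_sub_le {L : ℝ} (hL : 0 < L)
    (hg : StronglySmoothWith g L) (h0 : ∀ v w, 0 ≤ bregman g v w) (v w : W d) :
    ‖gradient g v - gradient g w‖ ^ 2 ≤ 2 * L * bregman g v w := by
  set Δ := gradient g v - gradient g w with hΔ
  -- A gradient step of length 1/L from `v` minimizes the quadratic upper model of the function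
  -- `bregman g · w`, whose gradient at `v` is `Δ`; the minimum is still nonnegative.
  have h1 := h0 (v - (1 / L) • Δ) w
  rw [bregman_three_point g _ v w, ← hΔ] at h1
  have h2 := hg.2 (v - (1 / L) • Δ) v
  have e : v - (1 / L) • Δ - v = -((1 / L) • Δ) := by abel
  rw [e] at h1 h2
  rw [norm_neg, norm_smul, Real.norm_of_nonneg (by positivity)] at h2
  rw [inner_neg_left, real_inner_smul_left, real_inner_self_eq_norm_sq] at h1
  have h3 : L / 2 * (1 / L * ‖Δ‖) ^ 2 = 1 / (2 * L) * ‖Δ‖ ^ 2 := by field_simp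
  rw [h3] at h2
  have h4 : 1 / (2 * L) * ‖Δ‖ ^ 2 ≤ bregman g v w := by
    have : 1 / L * ‖Δ‖ ^ 2 = 2 * (1 / (2 * L) * ‖Δ‖ ^ 2) := by field_simp
    linarith
  calc ‖Δ‖ ^ 2 = 2 * L * (1 / (2 * L) * ‖Δ‖ ^ 2) := by field_simp
    _ ≤ _ := by gcongr

lemma StronglySmoothWith.norm_sq_gradient_sub_le_inner {L : ℝ} (hL : 0 < L)
    (hg : StronglySmoothWith g L) (h0 : ∀ v w, 0 ≤ bregman g v w) (v w : W d) :
    ‖gradient g v - gradient g w‖ ^ 2 ≤ L * inner ℝ (v - w) (gradient g v - gradient g w) := by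
  have h1 := hg.norm_sq_gradient_sub_le hL h0 v w
  have h2 := hg.norm_sq_gradient_sub_le hL h0 w v
  rw [norm_sub_rev] at h2
  rw [← bregman_add_bregman_swap]
  linarith

lemma StronglySmoothWith.inner_gradient_sub_le {L : ℝ} (hg : StronglySmoothWith g L) (v w : W d) :
    inner ℝ (v - w) (gradient g v - gradient g w) ≤ L * ‖v - w‖ ^ 2 := by
  have h1 := hg.2 v w
  have h2 := hg.2 w v
  rw [norm_sub_rev] at h2
  rw [← bregman_add_bregman_swap]
  linarith

lemma StronglyConvexWith.le_inner_gradient_sub {σ : ℝ} (hg : StronglyConvexWith g σ) (v w : W d) :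
    σ * ‖v - w‖ ^ 2 ≤ inner ℝ (v - w) (gradient g v - gradient g w) := by
  have h1 := hg.2 v w
  have h2 := hg.2 w v
  rw [norm_sub_rev] at h2
  rw [← bregman_add_bregman_swap]
  linarith

lemma StronglyConvexWith.le_norm_gradient_sub {σ : ℝ} (hg : StronglyConvexWith g σ) (v w : W d) :
    σ * ‖v - w‖ ≤ ‖gradient g v - gradient g w‖ := by
  have h1 := hg.le_inner_gradient_sub v w
  have h2 := real_inner_le_norm (v - w) (gradient g v - gradient g w)
  rcases (norm_nonneg (v - w)).eq_or_lt with h | h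
  · rw [← h]; simp
  · refine le_of_mul_le_mul_left ?_ h
    linarith

/-- Adding the reverse distance gives an inner product; subtracting its lower bound leaves a
quadratic in ‖v - w‖, which is maximized by completing the square. -/
lemma StronglyConvexWith.bregman_le_norm_sq_gradient_sub {σ : ℝ} (hσ : 0 < σ)
    (hg : StronglyConvexWith g σ) (v w : W d) :
    2 * σ * bregman g v w ≤ ‖gradient g v - gradient g w‖ ^ 2 := by
  have h1 := bregman_add_bregman_swap g v w
  have h2 := real_inner_le_norm (v - w) (gradient g v - gradient g w)
  have h3 := hg.2 w v
  rw [norm_sub_rev] at h3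
  have h4 : bregman g v w ≤ ‖v - w‖ * ‖gradient g v - gradient g w‖ - σ / 2 * ‖v - w‖ ^ 2 := by
    linarith
  have h5 := mul_le_mul_of_nonneg_left h4 (by positivity : 0 ≤ 2 * σ)
  nlinarith [sq_nonneg (σ * ‖v - w‖ - ‖gradient g v - gradient g w‖)]

/-- Two distinct points are needed: in dimension zero every pair of constants is admissible. -/
lemma StronglyConvexWith.sigma_le {σ L : ℝ} (hg : StronglyConvexWith g σ)
    (hg' : StronglySmoothWith g L) {v w : W d} (h : v ≠ w) : σ ≤ L := by
  have h1 := (hg.2 v w).trans (hg'.2 v w)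
  have h2 : 0 < ‖v - w‖ ^ 2 := by
    have := norm_pos_iff.2 (sub_ne_zero.2 h)
    positivity
  have := le_of_mul_le_mul_right h1 h2
  linarith

/-- A gradient-like expansion whose remainder is quadratic determines the gradient. -/
lemma hasGradientAt_of_abs_sub_le {w G : W d} {C : ℝ}
    (h : ∀ v, |g v - g w - inner ℝ (v - w) G| ≤ C * ‖v - w‖ ^ 2) : HasGradientAt g G w := by
  rw [hasGradientAt_iff_isLittleO]
  have h1 : (fun v => g v - g w - inner ℝ G (v - w)) =O[𝓝 w] fun v => ‖v - w‖ ^ 2 := by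
    refine IsBigO.of_bound C (Eventually.of_forall fun v => ?_)
    rw [real_inner_comm, Real.norm_eq_abs, norm_pow, norm_norm]
    exact h v
  refine h1.trans_isLittleO ?_
  have h2 : Tendsto (fun v : W d => v - w) (𝓝 w) (𝓝 0) := by
    have : Tendsto (fun v : W d => v - w) (𝓝 w) (𝓝 (w - w)) := tendsto_id.sub_const w
    simpa using this
  simpa [Function.comp_def] using (isLittleO_norm_pow_id (E' := W d) one_lt_two).comp_tendsto h2

/-- The value of the function is at most quadratic at infinity. -/
def QuadraticallyBounded (g : W d → ℝ) : Prop := ∃ A : ℝ, ∀ v, g v ≤ A * (1 + ‖v‖ ^ 2)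

lemma StronglySmoothWith.quadraticallyBounded {L : ℝ} (hL : 0 < L)
    (hg : StronglySmoothWith g L) : QuadraticallyBounded g := by
  refine ⟨|g 0| + ‖gradient g 0‖ + L / 2, fun v => ?_⟩
  have h1 := hg.2 v 0
  have h2 := real_inner_le_norm v (gradient g 0)
  rw [bregman, sub_zero] at h1
  have h3 := le_abs_self (g 0)
  have h4 : ‖v‖ ≤ 1 + ‖v‖ ^ 2 := by nlinarith [sq_nonneg (‖v‖ - 1), sq_nonneg ‖v‖]
  have h5 := mul_le_mul_of_nonneg_right h4 (norm_nonneg (gradient g 0))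
  have h6 : 0 ≤ |g 0| * ‖v‖ ^ 2 := by positivity
  nlinarith

/-- A differentiable convex function of at most quadratic growth has a gradient of at most linear
growth. -/
lemma QuadraticallyBounded.exists_norm_gradient_le (hq : QuadraticallyBounded g)
    (h0 : ∀ v w, 0 ≤ bregman g v w) : ∃ B : ℝ, 0 ≤ B ∧ ∀ w, ‖gradient g w‖ ≤ B * (1 + ‖w‖) := by
  obtain ⟨A, hA⟩ := hq
  refine ⟨5 * |A| + |g 0| + ‖gradient g 0‖, by positivity, fun w => ?_⟩
  set N := ‖gradient g w‖ with hN
  rcases (norm_nonneg (gradient g w)).eq_or_lt with h | hpos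
  · rw [← hN] at h
    rw [← h]
    positivity
  set s := 1 + ‖w‖ with hs
  have hs1 : 1 ≤ s := by rw [hs]; linarith [norm_nonneg w]
  -- Moving by length `s` along the gradient raises a convex `g` by at least `s * N`. The growth
  -- bound controls `g (w + u)`, and the tangent at 0 controls `g w` from below.
  set u : W d := (s / N) • gradient g w with hu
  have hNne : N ≠ 0 := hpos.ne'
  have hun : ‖u‖ = s := by
    rw [hu, norm_smul, Real.norm_of_nonneg (by positivity), ← hN]
    field_simp
  have h1 := h0 (w + u) w
  rw [bregman, add_sub_cancel_left, hu, real_inner_smul_left, real_inner_self_eq_norm_sq, ← hN,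
    ← hu] at h1
  have h2 := h0 w 0
  rw [bregman, sub_zero] at h2
  have h3 : -(‖w‖ * ‖gradient g 0‖) ≤ inner ℝ w (gradient g 0) :=
    neg_le_of_abs_le (abs_real_inner_le_norm _ _)
  have h4 : g (w + u) ≤ |A| * (5 * s ^ 2) := by
    refine (hA _).trans ((mul_le_mul_of_nonneg_right (le_abs_self A) (by positivity)).trans ?_)
    have h5 : ‖w + u‖ ≤ 2 * s := by
      refine (norm_add_le _ _).trans ?_
      rw [hun, hs]; linarith
    have h6 : ‖w + u‖ ^ 2 ≤ (2 * s) ^ 2 := by gcongr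
    have h7 : 1 + ‖w + u‖ ^ 2 ≤ 5 * s ^ 2 := by nlinarith
    gcongr
  have h5 : s / N * N ^ 2 = s * N := by field_simp
  rw [h5] at h1
  have h6 : -|g 0| ≤ g 0 := neg_abs_le _
  have h7 : |g 0| ≤ |g 0| * s ^ 2 := le_mul_of_one_le_right (abs_nonneg _) (by nlinarith)
  have h8 : ‖w‖ * ‖gradient g 0‖ ≤ s ^ 2 * ‖gradient g 0‖ := by
    gcongr
    rw [hs]; nlinarith [norm_nonneg w]
  have h9 : s * N ≤ s * ((5 * |A| + |g 0| + ‖gradient g 0‖) * s) := by nlinarith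
  exact le_of_mul_le_mul_left h9 (by linarith)

/-- The gradient of a differentiable convex function is continuous. -/
lemma tendsto_gradient_of_bregman_nonneg (hd : Differentiable ℝ g)
    (h0 : ∀ v w, 0 ≤ bregman g v w) (a : W d) :
    Tendsto (gradient g) (𝓝 a) (𝓝 (gradient g a)) := by
  rw [Metric.tendsto_nhds]
  intro ε hε
  have h1 := (hasGradientAt_iff_isLittleO.1 (hd a).hasGradientAt).def
    (show (0 : ℝ) < ε / 4 by positivity)
  rw [Metric.eventually_nhds_iff] at h1 ⊢
  obtain ⟨r, hr, h1⟩ := h1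
  refine ⟨r / 2, by positivity, fun w hw => ?_⟩
  rw [dist_eq_norm]
  set Δ := gradient g w - gradient g a with hΔ
  by_contra hcon
  push Not at hcon
  have hΔpos : 0 < ‖Δ‖ := hε.trans_le hcon
  have hwa : 0 < ‖w - a‖ := by
    rw [norm_pos_iff]
    intro h
    rw [sub_eq_zero.1 h, sub_self] at hΔ
    simp [hΔ] at hΔpos
  rw [dist_eq_norm] at hw
  set t := ‖w - a‖ with ht
  -- In this direction convexity makes `bregman g (w + u) a` at least `t * ‖Δ‖`, while
  -- differentiability at `a` alone makes it at most `ε / 4 * (2 * t)`.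
  set u : W d := (t / ‖Δ‖) • Δ with hu
  have hun : ‖u‖ = t := by
    rw [hu, norm_smul, Real.norm_of_nonneg (by positivity)]
    field_simp
  have hdist : ‖w + u - a‖ ≤ 2 * t := by
    have : w + u - a = (w - a) + u := by abel
    rw [this]
    refine (norm_add_le _ _).trans ?_
    rw [hun, ← ht]; linarith
  have h2 := h1 (y := w + u) (by rw [dist_eq_norm]; linarith)
  rw [Real.norm_eq_abs] at h2
  have h3 : bregman g (w + u) a ≤ ε / 4 * ‖w + u - a‖ := by
    rw [bregman, real_inner_comm]
    exact (le_abs_self _).trans h2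
  have h4 := bregman_three_point g (w + u) w a
  rw [add_sub_cancel_left, ← hΔ, hu, real_inner_smul_left, real_inner_self_eq_norm_sq, ← hu] at h4
  have h5 : t / ‖Δ‖ * ‖Δ‖ ^ 2 = t * ‖Δ‖ := by field_simp
  have h6 := h0 (w + u) w
  have h7 := h0 w a
  have h8 : t * ‖Δ‖ ≤ ε / 4 * (2 * t) := by
    have : ε / 4 * ‖w + u - a‖ ≤ ε / 4 * (2 * t) := by gcongr
    linarith
  have h9 : t * ε ≤ t * ‖Δ‖ := by gcongr
  nlinarith

/-- Near `a` the limit gives the bound `δ`; at distance at least `r` the constant in the growth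
bound is absorbed by ‖a - w‖² / r². -/
lemma exists_le_add_mul_norm_sq {f : W d → ℝ} {a : W d} {B : ℝ} (hB : 0 ≤ B)
    (h1 : Tendsto f (𝓝 a) (𝓝 0)) (h2 : ∀ w, f w ≤ B * (1 + ‖a - w‖ ^ 2)) {δ : ℝ} (hδ : 0 < δ) :
    ∃ C : ℝ, 0 < C ∧ ∀ w, f w ≤ δ + C * ‖a - w‖ ^ 2 := by
  have h3 := h1.eventually (gt_mem_nhds hδ)
  rw [Metric.eventually_nhds_iff] at h3
  obtain ⟨r, hr, h3⟩ := h3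
  refine ⟨B * (1 / r ^ 2 + 1) + 1, by positivity, fun w => ?_⟩
  by_cases hw : ‖a - w‖ < r
  · have := h3 (y := w) (by rwa [dist_comm, dist_eq_norm])
    have h4 : 0 ≤ (B * (1 / r ^ 2 + 1) + 1) * ‖a - w‖ ^ 2 := by positivity
    linarith
  · push Not at hw
    refine (h2 w).trans ?_
    have h4 : 1 ≤ 1 / r ^ 2 * ‖a - w‖ ^ 2 := by
      rw [div_mul_eq_mul_div, one_mul, one_le_div (by positivity)]
      gcongr
    have h5 : B * (1 + ‖a - w‖ ^ 2) ≤ B * ((1 / r ^ 2 + 1) * ‖a - w‖ ^ 2) := by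
      gcongr
      linarith
    nlinarith [sq_nonneg ‖a - w‖]

lemma QuadraticallyBounded.exists_norm_gradient_sub_le (hq : QuadraticallyBounded g)
    (hd : Differentiable ℝ g) (h0 : ∀ v w, 0 ≤ bregman g v w) (a : W d) {δ : ℝ} (hδ : 0 < δ) :
    ∃ C : ℝ, 0 < C ∧ ∀ w, ‖gradient g w - gradient g a‖ ≤ δ + C * ‖a - w‖ ^ 2 := by
  obtain ⟨B, hB, h⟩ := hq.exists_norm_gradient_le h0
  refine exists_le_add_mul_norm_sq (B := B * (2 + ‖a‖) + ‖gradient g a‖) (by positivity) ?_ ?_ hδ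
  · have := ((tendsto_gradient_of_bregman_nonneg hd h0 a).sub_const (gradient g a)).norm
    simpa using this
  · intro w
    have h1 : ‖w‖ ≤ ‖a‖ + ‖a - w‖ := by
      have := norm_sub_le a (a - w)
      rwa [sub_sub_cancel] at this
    have h2 : ‖a - w‖ ≤ 1 + ‖a - w‖ ^ 2 := by nlinarith [sq_nonneg (‖a - w‖ - 1)]
    have h3 : 1 + ‖w‖ ≤ (2 + ‖a‖) * (1 + ‖a - w‖ ^ 2) := by
      nlinarith [norm_nonneg a, sq_nonneg ‖a - w‖, mul_nonneg (norm_nonneg a) (sq_nonneg ‖a - w‖)]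
    have h4 : B * (1 + ‖w‖) ≤ B * ((2 + ‖a‖) * (1 + ‖a - w‖ ^ 2)) := by gcongr
    have h5 := (norm_sub_le (gradient g w) (gradient g a)).trans
      (add_le_add ((h w).trans h4) le_rfl)
    nlinarith [mul_nonneg (norm_nonneg (gradient g a)) (sq_nonneg ‖a - w‖)]

/-- Replaces strong smoothness of the mirror map. The distance is at most ‖a - w‖ ‖∇g(w) - ∇g(a)‖,
which tends to zero at `a` and grows at most quadratically. -/
lemma QuadraticallyBounded.exists_bregman_le (hq : QuadraticallyBounded g)
    (hd : Differentiable ℝ g) (h0 : ∀ v w, 0 ≤ bregman g v w) (a : W d) {δ : ℝ} (hδ : 0 < δ) :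
    ∃ C : ℝ, 0 < C ∧ ∀ w, bregman g a w ≤ δ + C * ‖a - w‖ ^ 2 := by
  have key : ∀ w, bregman g a w ≤ ‖a - w‖ * ‖gradient g w - gradient g a‖ := by
    intro w
    have h1 := bregman_add_bregman_swap g a w
    have h2 := real_inner_le_norm (a - w) (gradient g a - gradient g w)
    rw [norm_sub_rev (gradient g a)] at h2
    linarith [h0 w a]
  obtain ⟨C, hC, h⟩ := hq.exists_norm_gradient_sub_le hd h0 a one_pos
  obtain ⟨B, hB, hG⟩ := hq.exists_norm_gradient_le h0
  refine exists_le_add_mul_norm_sq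
    (B := B * (2 + ‖a‖) + ‖gradient g a‖) (by positivity) ?_ ?_ hδ
  · have h1 := ((tendsto_gradient_of_bregman_nonneg hd h0 a).sub_const (gradient g a)).norm
    have h2 : Tendsto (fun w : W d => ‖a - w‖) (𝓝 a) (𝓝 0) := by
      have : Tendsto (fun w : W d => ‖a - w‖) (𝓝 a) (𝓝 ‖a - a‖) :=
        (tendsto_const_nhds.sub tendsto_id).norm
      simpa using this
    have h3 := h2.mul h1
    rw [zero_mul] at h3
    exact squeeze_zero (fun w => h0 a w) key h3
  · intro w
    have h1 : ‖w‖ ≤ ‖a‖ + ‖a - w‖ := by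
      have := norm_sub_le a (a - w)
      rwa [sub_sub_cancel] at this
    refine (key w).trans ?_
    have h5 := (norm_sub_le (gradient g w) (gradient g a)).trans (add_le_add (hG w) le_rfl)
    have h6 : ‖gradient g w - gradient g a‖ ≤ B * (1 + ‖a‖ + ‖a - w‖) + ‖gradient g a‖ := by
      refine h5.trans (add_le_add (mul_le_mul_of_nonneg_left ?_ hB) le_rfl)
      linarith
    have h7 : ‖a - w‖ ≤ 1 + ‖a - w‖ ^ 2 := by nlinarith [sq_nonneg (‖a - w‖ - 1)]
    have h7' : 0 ≤ ‖a‖ * (1 + ‖a - w‖ ^ 2 - ‖a - w‖) := mul_nonneg (norm_nonneg a) (by linarith)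
    have h8 : ‖a - w‖ * (1 + ‖a‖ + ‖a - w‖) ≤ (2 + ‖a‖) * (1 + ‖a - w‖ ^ 2) := by
      nlinarith [norm_nonneg (a - w)]
    calc ‖a - w‖ * ‖gradient g w - gradient g a‖
        ≤ ‖a - w‖ * (B * (1 + ‖a‖ + ‖a - w‖) + ‖gradient g a‖) := by gcongr
      _ = B * (‖a - w‖ * (1 + ‖a‖ + ‖a - w‖)) + ‖gradient g a‖ * ‖a - w‖ := by ring
      _ ≤ B * ((2 + ‖a‖) * (1 + ‖a - w‖ ^ 2)) + ‖gradient g a‖ * (1 + ‖a - w‖ ^ 2) := by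
        gcongr
      _ = _ := by ring

end Bregman

/-! ### One-variable convexity of the power function -/

section Scalar

lemma tangent_le_of_convexOn {D : Set ℝ} {f : ℝ → ℝ} (hf : ConvexOn ℝ D f) {x y f' : ℝ}
    (hx : x ∈ D) (hy : y ∈ D) (hd : HasDerivAt f f' x) : f x + f' * (y - x) ≤ f y := by
  rcases lt_trichotomy x y with h | h | h
  · have h1 := hf.le_slope_of_hasDerivAt hx hy h hd
    rw [slope_def_field, le_div_iff₀ (by linarith)] at h1
    linarith
  · subst h; simp
  · have h1 := hf.slope_le_of_hasDerivAt hy hx h hd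
    rw [slope_def_field, div_le_iff₀ (by linarith)] at h1
    linarith

/-- For p ≤ 2 the second derivative p(p-1)|x|^(p-2) is at least p(p-1)M^(p-2) when 0 < |x| ≤ M.
Since it may not exist at 0, the first derivative is shown monotone on [0, M) and the rest follows
by oddness. -/
lemma convexOn_abs_rpow_sub_sq {p M : ℝ} (hp : 1 < p) (hp2 : p ≤ 2) :
    ConvexOn ℝ (Set.Icc (-M) M)
      (fun x : ℝ => |x| ^ p - p * (p - 1) / 2 * M ^ (p - 2) * x ^ 2) := by
  set c := p * (p - 1) / 2 * M ^ (p - 2) with hc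
  have hder : ∀ x : ℝ, HasDerivAt (fun x : ℝ => |x| ^ p - c * x ^ 2)
      (p * |x| ^ (p - 2) * x - 2 * c * x) x := by
    intro x
    have h1 := (hasDerivAt_abs_rpow x hp).sub ((hasDerivAt_pow 2 x).const_mul c)
    refine h1.congr_deriv ?_
    push_cast
    ring
  have hdiff : Differentiable ℝ (fun x : ℝ => |x| ^ p - c * x ^ 2) :=
    fun x => (hder x).differentiableAt
  refine MonotoneOn.convexOn_of_deriv (convex_Icc _ _) hdiff.continuous.continuousOn
    hdiff.differentiableOn ?_
  have hderiv : deriv (fun x : ℝ => |x| ^ p - c * x ^ 2) =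
      fun x => p * |x| ^ (p - 2) * x - 2 * c * x := funext fun x => (hder x).deriv
  rw [hderiv, interior_Icc]
  set h : ℝ → ℝ := fun x => p * |x| ^ (p - 2) * x - 2 * c * x with hh
  have hodd : ∀ x, h (-x) = - h x := by
    intro x
    simp only [hh, abs_neg]
    ring
  have hpos : ∀ x, 0 ≤ x → h x = p * x ^ (p - 1) - 2 * c * x := by
    intro x hx
    simp only [hh, abs_of_nonneg hx]
    rcases hx.eq_or_lt with rfl | hx
    · rw [Real.zero_rpow (by linarith : p - 1 ≠ 0)]; simp
    · rw [mul_assoc, ← Real.rpow_add_one hx.ne']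
      congr 3
      ring
  have hmono : MonotoneOn h (Set.Ico 0 M) := by
    have h1 : MonotoneOn (fun x : ℝ => p * x ^ (p - 1) - 2 * c * x) (Set.Ico 0 M) := by
      have h2 : ∀ x ∈ interior (Set.Ico 0 M), HasDerivAt
          (fun x : ℝ => p * x ^ (p - 1) - 2 * c * x)
          (p * ((p - 1) * x ^ (p - 1 - 1)) - 2 * c * 1) x := by
        intro x hx
        rw [interior_Ico] at hx
        exact ((Real.hasDerivAt_rpow_const (Or.inl hx.1.ne')).const_mul p).sub
          ((hasDerivAt_id x).const_mul (2 * c))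
      refine monotoneOn_of_deriv_nonneg (convex_Ico _ _) ?_
        (fun x hx => (h2 x hx).differentiableAt.differentiableWithinAt) ?_
      · refine Continuous.continuousOn ?_
        have := Real.continuous_rpow_const (q := p - 1) (by linarith)
        fun_prop
      · intro x hx
        rw [(h2 x hx).deriv]
        rw [interior_Ico] at hx
        have h3 : M ^ (p - 2) ≤ x ^ (p - 2) :=
          Real.rpow_le_rpow_of_nonpos hx.1 hx.2.le (by linarith)
        have h4 : p - 1 - 1 = p - 2 := by ring
        rw [h4, hc]
        have h5 : 0 ≤ p * (p - 1) := mul_nonneg (by linarith) (by linarith)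
        nlinarith [mul_le_mul_of_nonneg_left h3 h5]
    exact h1.congr fun x hx => (hpos x hx.1).symm
  have h0 : h 0 = 0 := by simp [hh]
  intro x hx y hy hxy
  rcases le_total 0 x with h0x | h0x
  · exact hmono ⟨h0x, hx.2⟩ ⟨h0x.trans hxy, hy.2⟩ hxy
  · have hx' : (-x) ∈ Set.Ico 0 M := ⟨by linarith, by linarith [hx.1]⟩
    have hM : (0 : ℝ) ∈ Set.Ico 0 M := ⟨le_rfl, by linarith [hx'.1, hx'.2]⟩
    rcases le_total 0 y with h0y | h0y
    · have h1 := hmono hM ⟨h0y, hy.2⟩ h0y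
      have h2 := hmono hM hx' hx'.1
      rw [hodd] at h2
      linarith
    · have h2 := hmono (a := -y) (b := -x) ⟨by linarith, by linarith [hy.1]⟩ hx' (by linarith)
      rw [hodd, hodd] at h2
      linarith

/-- Quantitative strict convexity of `|x| ^ p` on a bounded interval. -/
lemma abs_rpow_tangent_add_sq_le {p M a b : ℝ} (hp : 1 < p) (hp2 : p ≤ 2) (ha : |a| ≤ M)
    (hb : |b| ≤ M) :
    |a| ^ p + p * (|a| ^ (p - 2) * a) * (b - a) + p * (p - 1) / 2 * M ^ (p - 2) * (b - a) ^ 2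
      ≤ |b| ^ p := by
  have h1 := tangent_le_of_convexOn (convexOn_abs_rpow_sub_sq (M := M) hp hp2) (abs_le.1 ha)
    (abs_le.1 hb) ((hasDerivAt_abs_rpow a hp).sub
      ((hasDerivAt_pow 2 a).const_mul (p * (p - 1) / 2 * M ^ (p - 2))))
  push_cast at h1
  nlinarith

end Scalar

/-! ### Strong convexity of the p-norm divergence -/

section PNorm

variable {d : ℕ} {p : ℝ}

/-- `∑ᵢ |w(i)|^p`. -/
def powSum (p : ℝ) (w : W d) : ℝ := ∑ i : Fin d, |w i| ^ p

/-- The `p`-norm. -/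
def pNorm (p : ℝ) (w : W d) : ℝ := powSum p w ^ (1 / p)

lemma powSum_nonneg (w : W d) : 0 ≤ powSum p w :=
  Finset.sum_nonneg fun _ _ => Real.rpow_nonneg (abs_nonneg _) _

lemma pNorm_nonneg (w : W d) : 0 ≤ pNorm p w := Real.rpow_nonneg (powSum_nonneg w) _

lemma pNormDivergence_eq_half_sq (w : W d) : pNormDivergence p w = 1 / 2 * pNorm p w ^ 2 := rfl

lemma pNormDivergence_eq_rpow (w : W d) :
    pNormDivergence p w = 1 / 2 * powSum p w ^ (2 / p) := by
  rw [pNormDivergence_eq_half_sq, pNorm, ← Real.rpow_natCast, ← Real.rpow_mul (powSum_nonneg w)]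
  congr 2
  push_cast
  ring

lemma pNorm_rpow (hp : 1 < p) (w : W d) : pNorm p w ^ p = powSum p w := by
  rw [pNorm, ← Real.rpow_mul (powSum_nonneg w), one_div, inv_mul_cancel₀ (by linarith),
    Real.rpow_one]

lemma abs_le_pNorm (hp : 1 < p) (w : W d) (i : Fin d) : |w i| ≤ pNorm p w := by
  refine (Real.rpow_le_rpow_iff (abs_nonneg _) (pNorm_nonneg w) (by linarith : 0 < p)).1 ?_
  rw [pNorm_rpow hp]
  exact Finset.single_le_sum (f := fun i => |w i| ^ p)
    (fun _ _ => Real.rpow_nonneg (abs_nonneg _) _) (Finset.mem_univ i)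

lemma norm_sq_le_card_mul {w : W d} {B : ℝ} (h : ∀ i, |w i| ≤ B) : ‖w‖ ^ 2 ≤ d * B ^ 2 := by
  rw [EuclideanSpace.norm_sq_eq]
  calc ∑ i, ‖w i‖ ^ 2 ≤ ∑ _i : Fin d, B ^ 2 := by
        refine Finset.sum_le_sum fun i _ => ?_
        rw [Real.norm_eq_abs]
        exact pow_le_pow_left₀ (abs_nonneg _) (h i) 2
    _ = _ := by simp

lemma powSum_le (hp : 1 < p) (w : W d) : powSum p w ≤ d * ‖w‖ ^ p := by
  calc powSum p w ≤ ∑ _i : Fin d, ‖w‖ ^ p := by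
        refine Finset.sum_le_sum fun i _ => ?_
        refine Real.rpow_le_rpow (abs_nonneg _) ?_ (by linarith)
        rw [← Real.norm_eq_abs]
        exact PiLp.norm_apply_le w i
    _ = _ := by simp

lemma quadraticallyBounded_pNormDivergence (hp : 1 < p) :
    QuadraticallyBounded (pNormDivergence (d := d) p) := by
  refine ⟨1 / 2 * (d : ℝ) ^ (2 / p), fun w => ?_⟩
  have h1 : powSum p w ^ (2 / p) ≤ (d * ‖w‖ ^ p) ^ (2 / p) :=
    Real.rpow_le_rpow (powSum_nonneg w) (powSum_le hp w) (by positivity)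
  have h2 : (d * ‖w‖ ^ p) ^ (2 / p) = (d : ℝ) ^ (2 / p) * ‖w‖ ^ 2 := by
    rw [Real.mul_rpow (by positivity) (by positivity), ← Real.rpow_mul (norm_nonneg w),
      mul_div_cancel₀ _ (by linarith : p ≠ 0)]
    norm_num
  rw [pNormDivergence_eq_rpow]
  have h3 : 0 ≤ (d : ℝ) ^ (2 / p) := by positivity
  nlinarith

/-- Since 2/p ≥ 1, the outer power is differentiable at 0 too, so the chain rule covers the origin.
-/
lemma hasGradientAt_pNormDivergence (hp : 1 < p) (hp2 : p ≤ 2) (w : W d) :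
    HasGradientAt (pNormDivergence p)
      (WithLp.toLp 2 fun i => powSum p w ^ (2 / p - 1) * (|w i| ^ (p - 2) * w i)) w := by
  have h1 : ∀ i : Fin d, HasFDerivAt (fun v : W d => |v i| ^ p)
      ((p * |w i| ^ (p - 2) * w i) • (EuclideanSpace.proj i : W d →L[ℝ] ℝ)) w := fun i =>
    HasDerivAt.comp_hasFDerivAt (h₂ := fun x : ℝ => |x| ^ p) w (hasDerivAt_abs_rpow (w i) hp)
      (EuclideanSpace.proj i : W d →L[ℝ] ℝ).hasFDerivAt
  have h2 := (HasFDerivAt.fun_sum (u := Finset.univ) fun i _ => h1 i).rpow_const (p := 2 / p)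
    (Or.inr ((one_le_div (by linarith)).2 hp2))
  have h3 := h2.const_mul (1 / 2)
  rw [hasGradientAt_iff_hasFDerivAt]
  have h4 : pNormDivergence (d := d) p = fun v => 1 / 2 * (∑ i, |v i| ^ p) ^ (2 / p) :=
    funext fun v => pNormDivergence_eq_rpow v
  rw [h4]
  refine h3.congr_fderiv ?_
  ext v
  simp only [_root_.smul_apply, _root_.sum_apply,
    InnerProductSpace.toDual_apply_apply, PiLp.inner_apply, smul_eq_mul, PiLp.proj_apply,
    Finset.mul_sum, RCLike.inner_apply, conj_trivial]
  refine Finset.sum_congr rfl fun i _ => ?_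
  change _ = v i * (powSum p w ^ (2 / p - 1) * (|w i| ^ (p - 2) * w i))
  simp only [powSum]
  have : p ≠ 0 := by linarith
  field_simp

lemma inner_gradient_pNormDivergence (hp : 1 < p) (hp2 : p ≤ 2) (u w : W d) :
    inner ℝ u (gradient (pNormDivergence p) w) =
      powSum p w ^ (2 / p - 1) * ∑ i, |w i| ^ (p - 2) * w i * u i := by
  rw [(hasGradientAt_pNormDivergence hp hp2 w).gradient, PiLp.inner_apply, Finset.mul_sum]
  refine Finset.sum_congr rfl fun i _ => ?_
  simp only [RCLike.inner_apply, conj_trivial]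
  ring

/-- Only some positive constant is needed, so a crude case split suffices. If ‖v‖_p ≤ K‖w‖_p, the
coordinatewise estimate is summed and pushed through the tangent of r ↦ r^(2/p), where the powers of
‖w‖_p cancel. If ‖v‖_p is larger, its square dominates every other term. The case w = 0 is direct.
-/
lemma stronglyConvexWith_pNormDivergence (hp : 1 < p) (hp2 : p ≤ 2) :
    ∃ σ : ℝ, 0 < σ ∧ StronglyConvexWith (pNormDivergence (d := d) p) σ := by
  have hp0 : 0 < p := by linarith
  -- `K` makes the cross term `d * s * n` at most `n ^ 2 / 4` in the far case; the second entry of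
  -- `τ` makes `τ * (d * (2 * n) ^ 2)` at most `n ^ 2 / 4`. The first entry of `τ` is the constant
  -- of the near case.
  set K : ℝ := 4 * (d + 1) with hK
  have hK0 : 0 < K := by positivity
  have hK1 : 1 ≤ K := by rw [hK]; linarith [(Nat.cast_nonneg d : (0 : ℝ) ≤ d)]
  set τ : ℝ := min ((p - 1) / 2 * K ^ (p - 2)) (1 / (16 * (d + 1))) with hτ
  have hτ0 : 0 < τ := lt_min (mul_pos (by linarith) (Real.rpow_pos_of_pos hK0 _)) (by positivity)
  have hτ2 : τ * (16 * (d + 1)) ≤ 1 := by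
    rw [← le_div_iff₀ (by positivity)]
    exact min_le_right _ _
  refine ⟨2 * τ, by positivity,
    fun w => (hasGradientAt_pNormDivergence hp hp2 w).differentiableAt, fun v w => ?_⟩
  rw [show 2 * τ / 2 = τ by ring, bregman, inner_gradient_pNormDivergence hp hp2]
  set s := pNorm p w with hs
  set n := pNorm p v with hn
  have hs0 : 0 ≤ s := pNorm_nonneg w
  have hn0 : 0 ≤ n := pNorm_nonneg v
  rcases hs0.eq_or_lt with h0 | hspos
  · have hw : ∀ i, w i = 0 := fun i => by
      have := abs_le_pNorm hp w i
      rw [← hs, ← h0] at this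
      exact abs_nonpos_iff.1 this
    have h1 : ‖v - w‖ ^ 2 ≤ d * n ^ 2 := norm_sq_le_card_mul fun i => by
      simpa [hw i] using abs_le_pNorm hp v i
    have h2 : ∑ i, |w i| ^ (p - 2) * w i * (v - w) i = 0 :=
      Finset.sum_eq_zero fun i _ => by simp [hw i]
    rw [h2, pNormDivergence_eq_half_sq, pNormDivergence_eq_half_sq, ← hs, ← hn, ← h0]
    have h3 : τ * ‖v - w‖ ^ 2 ≤ τ * (d * n ^ 2) := by gcongr
    nlinarith [sq_nonneg n, mul_nonneg hτ0.le (sq_nonneg n)]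
  have hS : powSum p w = s ^ p := (pNorm_rpow hp w).symm
  have hSpos : 0 < powSum p w := by rw [hS]; positivity
  have hScale : powSum p w ^ (2 / p - 1) = s ^ (2 - p) := by
    rw [hS, ← Real.rpow_mul hs0]
    congr 1
    field_simp
  rcases le_or_gt n (K * s) with hle | hgt
  · have h1 : ∀ i, |w i| ^ p + p * (|w i| ^ (p - 2) * w i) * (v i - w i)
        + p * (p - 1) / 2 * (K * s) ^ (p - 2) * (v i - w i) ^ 2 ≤ |v i| ^ p := fun i =>
      abs_rpow_tangent_add_sq_le hp hp2
        ((abs_le_pNorm hp w i).trans (by rw [← hs]; nlinarith))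
        ((abs_le_pNorm hp v i).trans hle)
    have h2 := Finset.sum_le_sum fun i (_ : i ∈ Finset.univ) => h1 i
    rw [Finset.sum_add_distrib, Finset.sum_add_distrib] at h2
    have h3 : ∑ i, p * (|w i| ^ (p - 2) * w i) * (v i - w i) =
        p * ∑ i, |w i| ^ (p - 2) * w i * (v - w) i := by
      rw [Finset.mul_sum]
      refine Finset.sum_congr rfl fun i _ => ?_
      rw [PiLp.sub_apply]; ring
    have h4 : ∑ i, p * (p - 1) / 2 * (K * s) ^ (p - 2) * (v i - w i) ^ 2 =
        p * (p - 1) / 2 * (K * s) ^ (p - 2) * ‖v - w‖ ^ 2 := by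
      rw [EuclideanSpace.norm_sq_eq, Finset.mul_sum]
      refine Finset.sum_congr rfl fun i _ => ?_
      rw [PiLp.sub_apply, Real.norm_eq_abs, sq_abs]
    rw [h3, h4] at h2
    change powSum p w + _ + _ ≤ powSum p v at h2
    have h5 := tangent_le_of_convexOn (convexOn_rpow ((one_le_div hp0).2 hp2))
      (powSum_nonneg (p := p) w) (powSum_nonneg (p := p) v) (Real.hasDerivAt_rpow_const (Or.inl hSpos.ne'))
    rw [pNormDivergence_eq_rpow, pNormDivergence_eq_rpow]
    rw [hScale] at h5 ⊢
    set A := ∑ i, |w i| ^ (p - 2) * w i * (v - w) i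
    have h6 : s ^ (2 - p) * (K * s) ^ (p - 2) = K ^ (p - 2) := by
      rw [Real.mul_rpow hK0.le hs0, mul_left_comm, ← Real.rpow_add hspos]
      norm_num
    have h7 : s ^ (2 - p) * (p * A + p * (p - 1) / 2 * (K * s) ^ (p - 2) * ‖v - w‖ ^ 2)
        ≤ s ^ (2 - p) * (powSum p v - powSum p w) := by
      gcongr
      linarith
    have h8 : s ^ (2 - p) * (p * A + p * (p - 1) / 2 * (K * s) ^ (p - 2) * ‖v - w‖ ^ 2)
        = p * (s ^ (2 - p) * A) + p * ((p - 1) / 2 * K ^ (p - 2)) * ‖v - w‖ ^ 2 := by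
      rw [← h6]; ring
    rw [h8] at h7
    have h9 : s ^ (2 - p) * A + (p - 1) / 2 * K ^ (p - 2) * ‖v - w‖ ^ 2
        ≤ 1 / p * (s ^ (2 - p) * (powSum p v - powSum p w)) := by
      rw [one_div, ← div_eq_inv_mul, le_div_iff₀ hp0]
      linarith
    have h10 : τ * ‖v - w‖ ^ 2 ≤ (p - 1) / 2 * K ^ (p - 2) * ‖v - w‖ ^ 2 := by
      gcongr
      exact min_le_left _ _
    have h11 : 2 / p * s ^ (2 - p) * (powSum p v - powSum p w) =
        2 * (1 / p * (s ^ (2 - p) * (powSum p v - powSum p w))) := by ring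
    rw [h11] at h5
    linarith
  · have h1 : ∑ i, |w i| ^ (p - 2) * w i * (v - w) i ≤ d * (s ^ (p - 1) * n) - s ^ p := by
      have h2 : ∀ i, |w i| ^ (p - 2) * w i * (v - w) i ≤ s ^ (p - 1) * n - |w i| ^ p := by
        intro i
        rcases eq_or_ne (w i) 0 with hw | hw
        · rw [hw, abs_zero, Real.zero_rpow hp0.ne']
          simp only [mul_zero, zero_mul, sub_zero]
          positivity
        · have hw' := abs_pos.2 hw
          have h3 : |w i| ^ p = |w i| ^ (p - 2) * w i * w i := by
            rw [mul_assoc, ← sq, ← sq_abs (w i), ← Real.rpow_natCast, ← Real.rpow_add hw']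
            norm_num
          have h4 : |w i| ^ (p - 2) * |w i| = |w i| ^ (p - 1) := by
            rw [← Real.rpow_add_one hw'.ne']
            congr 1; ring
          have h5 : |w i| ^ (p - 2) * w i * v i ≤ s ^ (p - 1) * n := by
            calc |w i| ^ (p - 2) * w i * v i ≤ |(|w i| ^ (p - 2) * w i * v i)| := le_abs_self _
              _ = |w i| ^ (p - 1) * |v i| := by
                rw [abs_mul, abs_mul, abs_of_nonneg (Real.rpow_nonneg hw'.le _), h4]
              _ ≤ s ^ (p - 1) * n := by
                have h6 : |w i| ^ (p - 1) ≤ s ^ (p - 1) :=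
                  Real.rpow_le_rpow hw'.le (abs_le_pNorm hp w i) (by linarith)
                exact mul_le_mul h6 (abs_le_pNorm hp v i) (abs_nonneg _) (by positivity)
          rw [PiLp.sub_apply, mul_sub, ← h3]
          linarith
      refine (Finset.sum_le_sum fun i _ => h2 i).trans_eq ?_
      rw [Finset.sum_sub_distrib, ← hS]
      simp [powSum]
    rw [hScale, pNormDivergence_eq_half_sq, pNormDivergence_eq_half_sq, ← hs, ← hn]
    have h2 : s ^ (2 - p) * ∑ i, |w i| ^ (p - 2) * w i * (v - w) i ≤
        s ^ (2 - p) * (d * (s ^ (p - 1) * n) - s ^ p) := by gcongr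
    have h3 : s ^ (2 - p) * s ^ (p - 1) = s := by
      rw [← Real.rpow_add hspos]; norm_num
    have h4 : s ^ (2 - p) * s ^ p = s ^ 2 := by
      rw [← Real.rpow_add hspos]; norm_num
    have h5 : s ^ (2 - p) * (d * (s ^ (p - 1) * n) - s ^ p) = d * s * n - s ^ 2 := by
      rw [mul_sub, h4]
      linear_combination (d * n : ℝ) * h3
    rw [h5] at h2
    have hsn : s ≤ n := by nlinarith
    have h6 : ‖v - w‖ ^ 2 ≤ d * (2 * n) ^ 2 := norm_sq_le_card_mul fun i => by
      rw [PiLp.sub_apply]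
      have := (abs_sub (v i) (w i)).trans (add_le_add (abs_le_pNorm hp v i) (abs_le_pNorm hp w i))
      rw [← hs, ← hn] at this
      linarith
    have h7 : τ * ‖v - w‖ ^ 2 ≤ τ * (d * (2 * n) ^ 2) := by gcongr
    have h8 : d * s * n ≤ 1 / 4 * n ^ 2 := by
      have : 4 * (d * s) ≤ n := by rw [hK] at hgt; nlinarith
      nlinarith
    have h9 : τ * (d * (2 * n) ^ 2) ≤ 1 / 4 * n ^ 2 := by
      nlinarith [mul_le_mul_of_nonneg_right hτ2 (sq_nonneg n), mul_nonneg hτ0.le (sq_nonneg n)]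
    nlinarith [sq_nonneg s]

end PNorm

/-! ### The two kinds of mirror map -/

section Admissible

variable {d : ℕ} {Ψ : W d → ℝ}

lemma AdmissibleMirrorMap.exists_stronglyConvexWith (h : AdmissibleMirrorMap Ψ) :
    ∃ σ : ℝ, 0 < σ ∧ StronglyConvexWith Ψ σ := by
  rcases h with ⟨p, hp, hp2, rfl⟩ | ⟨h, -⟩
  · exact stronglyConvexWith_pNormDivergence hp hp2
  · exact h

lemma AdmissibleMirrorMap.quadraticallyBounded (h : AdmissibleMirrorMap Ψ) :
    QuadraticallyBounded Ψ := by
  rcases h with ⟨p, hp, -, rfl⟩ | ⟨-, L, hL, h⟩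
  · exact quadraticallyBounded_pNormDivergence hp
  · exact h.quadraticallyBounded hL

end Admissible

/-- A measurable nonnegative loss, convex and differentiable in its first variable with a Lipschitz
derivative, on a bounded set of inputs and with a positive regularization parameter. -/
structure IsSmoothLoss {d : ℕ} (𝒳 : Set (W d)) (𝒴 : Set ℝ) (φ : ℝ → ℝ → ℝ) (lam : ℝ) :
    Prop where
  lam_pos : 0 < lam
  bddAbove : BddAbove ((fun x => ‖x‖) '' 𝒳)
  measurable : Measurable (Function.uncurry φ)
  nonneg : ∀ a, ∀ y ∈ 𝒴, 0 ≤ φ a y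
  convex : ∀ y ∈ 𝒴, ConvexOn ℝ Set.univ (fun a => φ a y)
  differentiable : ∀ y ∈ 𝒴, Differentiable ℝ (fun a => φ a y)
  bddAbove_lip : BddAbove (lipQuotients φ 𝒴)

/-! ### Regularized losses: gradients, smoothness and measurability -/

namespace IsSmoothLoss

variable {d : ℕ} {𝒳 : Set (W d)} {𝒴 : Set ℝ} {φ : ℝ → ℝ → ℝ} {lam : ℝ}

lemma lipConst_nonneg (φ : ℝ → ℝ → ℝ) (𝒴 : Set ℝ) : 0 ≤ lipConst φ 𝒴 := by
  refine Real.sSup_nonneg ?_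
  rintro q ⟨u, v, y, -, -, rfl⟩
  positivity

lemma smoothConst_pos (h : IsSmoothLoss 𝒳 𝒴 φ lam) : 0 < smoothConst 𝒳 𝒴 φ lam := by
  have h1 := lipConst_nonneg φ 𝒴
  have h2 := h.lam_pos
  rw [smoothConst]
  positivity

lemma abs_lossDeriv_sub_le (h : IsSmoothLoss 𝒳 𝒴 φ lam) {y : ℝ} (hy : y ∈ 𝒴) (u v : ℝ) :
    |lossDeriv φ u y - lossDeriv φ v y| ≤ lipConst φ 𝒴 * |u - v| := by
  rcases eq_or_ne u v with rfl | huv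
  · simp
  · rw [← div_le_iff₀ (abs_pos.2 (sub_ne_zero.2 huv))]
    exact le_csSup h.bddAbove_lip ⟨u, v, y, huv, hy, rfl⟩

lemma hasDerivAt_loss (h : IsSmoothLoss 𝒳 𝒴 φ lam) {y : ℝ} (hy : y ∈ 𝒴) (u : ℝ) :
    HasDerivAt (fun a => φ a y) (lossDeriv φ u y) u :=
  (h.differentiable y hy u).hasDerivAt

lemma tangent_le_loss (h : IsSmoothLoss 𝒳 𝒴 φ lam) {y : ℝ} (hy : y ∈ 𝒴) (u v : ℝ) :
    φ u y + lossDeriv φ u y * (v - u) ≤ φ v y :=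
  tangent_le_of_convexOn (h.convex y hy) (Set.mem_univ u) (Set.mem_univ v) (h.hasDerivAt_loss hy u)

/-- The tangent inequality at `v` and the Lipschitz bound suffice without integrating the
derivative. The price is the constant ℓ_φ in place of ℓ_φ/2, and this is the form that matches L =
2(ℓ_φ R² + λ). -/
lemma loss_le_tangent_add (h : IsSmoothLoss 𝒳 𝒴 φ lam) {y : ℝ} (hy : y ∈ 𝒴) (u v : ℝ) :
    φ v y ≤ φ u y + lossDeriv φ u y * (v - u) + lipConst φ 𝒴 * (v - u) ^ 2 := by
  have h1 := h.tangent_le_loss hy v u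
  have h2 : (lossDeriv φ v y - lossDeriv φ u y) * (v - u) ≤ lipConst φ 𝒴 * (v - u) ^ 2 := by
    calc _ ≤ |(lossDeriv φ v y - lossDeriv φ u y) * (v - u)| := le_abs_self _
      _ = |lossDeriv φ v y - lossDeriv φ u y| * |v - u| := abs_mul _ _
      _ ≤ lipConst φ 𝒴 * |v - u| * |v - u| := by
        gcongr
        exact h.abs_lossDeriv_sub_le hy v u
      _ = _ := by rw [mul_assoc, abs_mul_abs_self, sq]
  linarith

lemma norm_le_radius (h : IsSmoothLoss 𝒳 𝒴 φ lam) (x : 𝒳) : ‖(x : W d)‖ ≤ radius 𝒳 :=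
  le_csSup h.bddAbove ⟨x, x.2, rfl⟩

lemma hasGradientAt_regLoss (h : IsSmoothLoss 𝒳 𝒴 φ lam) (w : W d) (s : 𝒳 × 𝒴) :
    HasGradientAt (fun v => regLoss φ lam v s)
      (lossDeriv φ (inner ℝ w (s.1 : W d)) s.2 • (s.1 : W d) + (2 * lam) • w) w := by
  refine hasGradientAt_of_abs_sub_le
    (C := lipConst φ 𝒴 * ‖(s.1 : W d)‖ ^ 2 + lam) fun v => ?_
  have h1 := h.tangent_le_loss s.2.2 (inner ℝ w (s.1 : W d)) (inner ℝ v (s.1 : W d))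
  have h2 := h.loss_le_tangent_add s.2.2 (inner ℝ w (s.1 : W d)) (inner ℝ v (s.1 : W d))
  have h3 : (inner ℝ v (s.1 : W d) - inner ℝ w (s.1 : W d)) ^ 2 ≤
      ‖v - w‖ ^ 2 * ‖(s.1 : W d)‖ ^ 2 := by
    rw [← inner_sub_left, ← mul_pow, ← sq_abs]
    exact pow_le_pow_left₀ (abs_nonneg _) (abs_real_inner_le_norm _ _) 2
  have h4 := mul_le_mul_of_nonneg_left h3 (lipConst_nonneg φ 𝒴)
  have h5 := norm_sub_sq_real v w
  have h6 : 0 ≤ lam * ‖v - w‖ ^ 2 := by have := h.lam_pos; positivity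
  have h7 : inner ℝ (v - w) w = inner ℝ v w - ‖w‖ ^ 2 := by
    rw [inner_sub_left, real_inner_self_eq_norm_sq]
  rw [inner_add_right, real_inner_smul_right, real_inner_smul_right, h7, inner_sub_left]
  simp only [regLoss]
  have h8 : 0 ≤ lipConst φ 𝒴 * (‖v - w‖ ^ 2 * ‖(s.1 : W d)‖ ^ 2) :=
    mul_nonneg (lipConst_nonneg φ 𝒴) (by positivity)
  have h9 : lam * ‖v - w‖ ^ 2 = lam * (‖v‖ ^ 2 - 2 * inner ℝ v w + ‖w‖ ^ 2) := by rw [h5]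
  rw [abs_le]
  constructor <;> linarith

lemma regLossGrad_eq (h : IsSmoothLoss 𝒳 𝒴 φ lam) (w : W d) (s : 𝒳 × 𝒴) :
    regLossGrad φ lam w s =
      lossDeriv φ (inner ℝ w (s.1 : W d)) s.2 • (s.1 : W d) + (2 * lam) • w :=
  (h.hasGradientAt_regLoss w s).gradient

lemma bregman_regLoss_eq (h : IsSmoothLoss 𝒳 𝒴 φ lam) (v w : W d) (s : 𝒳 × 𝒴) :
    bregman (fun w => regLoss φ lam w s) v w =
      φ (inner ℝ v (s.1 : W d)) s.2 - φ (inner ℝ w (s.1 : W d)) s.2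
        - lossDeriv φ (inner ℝ w (s.1 : W d)) s.2 *
          (inner ℝ v (s.1 : W d) - inner ℝ w (s.1 : W d)) + lam * ‖v - w‖ ^ 2 := by
  have h7 : inner ℝ (v - w) w = inner ℝ v w - ‖w‖ ^ 2 := by
    rw [inner_sub_left, real_inner_self_eq_norm_sq]
  rw [bregman, (h.hasGradientAt_regLoss w s).gradient, inner_add_right, real_inner_smul_right,
    real_inner_smul_right, h7, inner_sub_left, norm_sub_sq_real]
  simp only [regLoss]
  ring

lemma le_bregman_regLoss (h : IsSmoothLoss 𝒳 𝒴 φ lam) (v w : W d) (s : 𝒳 × 𝒴) :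
    lam * ‖v - w‖ ^ 2 ≤ bregman (fun w => regLoss φ lam w s) v w := by
  have h1 := h.tangent_le_loss s.2.2 (inner ℝ w (s.1 : W d)) (inner ℝ v (s.1 : W d))
  rw [h.bregman_regLoss_eq]
  linarith

lemma bregman_regLoss_le (h : IsSmoothLoss 𝒳 𝒴 φ lam) (v w : W d) (s : 𝒳 × 𝒴) :
    bregman (fun w => regLoss φ lam w s) v w ≤ smoothConst 𝒳 𝒴 φ lam / 2 * ‖v - w‖ ^ 2 := by
  have h2 := h.loss_le_tangent_add s.2.2 (inner ℝ w (s.1 : W d)) (inner ℝ v (s.1 : W d))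
  have h3 : (inner ℝ v (s.1 : W d) - inner ℝ w (s.1 : W d)) ^ 2 ≤
      (‖v - w‖ * radius 𝒳) ^ 2 := by
    rw [← inner_sub_left, ← sq_abs]
    refine pow_le_pow_left₀ (abs_nonneg _) ((abs_real_inner_le_norm _ _).trans ?_) 2
    gcongr
    exact h.norm_le_radius s.1
  have h4 := mul_le_mul_of_nonneg_left h3 (lipConst_nonneg φ 𝒴)
  rw [h.bregman_regLoss_eq, smoothConst]
  linarith

lemma stronglySmoothWith_regLoss (h : IsSmoothLoss 𝒳 𝒴 φ lam) (s : 𝒳 × 𝒴) :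
    StronglySmoothWith (fun w => regLoss φ lam w s) (smoothConst 𝒳 𝒴 φ lam) :=
  ⟨fun w => (h.hasGradientAt_regLoss w s).differentiableAt, fun v w => h.bregman_regLoss_le v w s⟩

lemma stronglyConvexWith_regLoss (h : IsSmoothLoss 𝒳 𝒴 φ lam) (s : 𝒳 × 𝒴) :
    StronglyConvexWith (fun w => regLoss φ lam w s) (2 * lam) :=
  ⟨fun w => (h.hasGradientAt_regLoss w s).differentiableAt, fun v w => by
    simpa using h.le_bregman_regLoss v w s⟩

lemma regLoss_nonneg (h : IsSmoothLoss 𝒳 𝒴 φ lam) (w : W d) (s : 𝒳 × 𝒴) :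
    0 ≤ regLoss φ lam w s := by
  have h1 := h.nonneg (inner ℝ w (s.1 : W d)) s.2 s.2.2
  have h2 := h.lam_pos
  rw [regLoss]
  positivity

/-- Nonnegative smooth functions have gradients bounded by their values. -/
lemma norm_sq_regLossGrad_le (h : IsSmoothLoss 𝒳 𝒴 φ lam) (w : W d) (s : 𝒳 × 𝒴) :
    ‖regLossGrad φ lam w s‖ ^ 2 ≤ 2 * smoothConst 𝒳 𝒴 φ lam * regLoss φ lam w s := by
  set L := smoothConst 𝒳 𝒴 φ lam with hL
  have hL0 : 0 < L := h.smoothConst_pos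
  set G := regLossGrad φ lam w s with hG
  -- The loss after a gradient step of length 1/L is still nonnegative, so the guaranteed decrease
  -- ‖G‖²/(2L) cannot exceed the loss at `w`.
  have h1 := h.bregman_regLoss_le (w - (1 / L) • G) w s
  have h2 := h.regLoss_nonneg (w - (1 / L) • G) s
  have e : w - (1 / L) • G - w = -((1 / L) • G) := by abel
  rw [bregman, e] at h1
  change _ - _ - inner ℝ _ G ≤ _ at h1
  rw [norm_neg, norm_smul, Real.norm_of_nonneg (by positivity), inner_neg_left,
    real_inner_smul_left, real_inner_self_eq_norm_sq, ← hL] at h1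
  have h3 : L / 2 * (1 / L * ‖G‖) ^ 2 = 1 / (2 * L) * ‖G‖ ^ 2 := by field_simp
  have h5 : 1 / L * ‖G‖ ^ 2 = 2 * (1 / (2 * L) * ‖G‖ ^ 2) := by field_simp
  have h4 : 1 / (2 * L) * ‖G‖ ^ 2 ≤ regLoss φ lam w s := by linarith
  calc ‖G‖ ^ 2 = 2 * L * (1 / (2 * L) * ‖G‖ ^ 2) := by field_simp
    _ ≤ _ := by gcongr

/-- The derivative is a pointwise limit of difference quotients with steps 1/(n+1), each jointly
measurable. -/
lemma measurable_lossDeriv (h : IsSmoothLoss 𝒳 𝒴 φ lam) :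
    Measurable (fun q : ℝ × 𝒴 => lossDeriv φ q.1 q.2) := by
  refine measurable_of_tendsto_metrizable (f := fun (n : ℕ) (q : ℝ × 𝒴) =>
    (1 / ((n : ℝ) + 1))⁻¹ • (φ (q.1 + 1 / ((n : ℝ) + 1)) q.2 - φ q.1 q.2)) (fun n => ?_) ?_
  · have h1 : Measurable fun q : ℝ × 𝒴 => φ (q.1 + 1 / ((n : ℝ) + 1)) q.2 :=
      h.measurable.comp (f := fun q : ℝ × 𝒴 => (q.1 + 1 / ((n : ℝ) + 1), (q.2 : ℝ))) (by fun_prop)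
    have h2 : Measurable fun q : ℝ × 𝒴 => φ q.1 q.2 :=
      h.measurable.comp (f := fun q : ℝ × 𝒴 => (q.1, (q.2 : ℝ))) (by fun_prop)
    exact (h1.sub h2).const_mul (1 / ((n : ℝ) + 1))⁻¹
  · rw [tendsto_pi_nhds]
    intro q
    have h1 := hasDerivAt_iff_tendsto_slope_zero.1 (h.hasDerivAt_loss q.2.2 q.1)
    refine h1.comp (tendsto_nhdsWithin_iff.2
      ⟨tendsto_one_div_add_atTop_nhds_zero_nat, Eventually.of_forall fun n => ?_⟩)
    have : (0 : ℝ) < 1 / ((n : ℝ) + 1) := by positivity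
    exact this.ne'

lemma measurable_regLossGrad (h : IsSmoothLoss 𝒳 𝒴 φ lam) :
    Measurable (fun q : W d × (𝒳 × 𝒴) => regLossGrad φ lam q.1 q.2) := by
  have h0 : (fun q : W d × (𝒳 × 𝒴) => regLossGrad φ lam q.1 q.2) = fun q =>
      lossDeriv φ (inner ℝ q.1 (q.2.1 : W d)) q.2.2 • (q.2.1 : W d) + (2 * lam) • q.1 :=
    funext fun q => h.regLossGrad_eq q.1 q.2
  rw [h0]
  have h1 : Measurable fun q : W d × (𝒳 × 𝒴) => (q.2.1 : W d) := by fun_prop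
  have h2 : Measurable fun q : W d × (𝒳 × 𝒴) => inner ℝ q.1 (q.2.1 : W d) :=
    measurable_fst.inner h1
  have h3 : Measurable fun q : W d × (𝒳 × 𝒴) =>
      lossDeriv φ (inner ℝ q.1 (q.2.1 : W d)) q.2.2 :=
    h.measurable_lossDeriv.comp (h2.prodMk (by fun_prop : Measurable
      fun q : W d × (𝒳 × 𝒴) => q.2.2))
  have h4 : Measurable fun q : W d × (𝒳 × 𝒴) => (2 * lam) • q.1 := by fun_prop
  exact (h3.smul h1).add h4

lemma measurable_regLossGrad_right (h : IsSmoothLoss 𝒳 𝒴 φ lam) (w : W d) :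
    Measurable (fun s : 𝒳 × 𝒴 => regLossGrad φ lam w s) :=
  h.measurable_regLossGrad.comp (f := fun s => (w, s)) measurable_prodMk_left

/-! ### The risk inherits smoothness and strong convexity -/

section Risk

variable {ρ : Measure (𝒳 × 𝒴)}

/-- The bound of the squared gradient by the loss makes integrability of the loss enough for a
finite variance. -/
lemma integrable_norm_sq_regLossGrad (h : IsSmoothLoss 𝒳 𝒴 φ lam) {w : W d}
    (hF : Integrable (fun s : 𝒳 × 𝒴 => regLoss φ lam w s) ρ) :
    Integrable (fun s => ‖regLossGrad φ lam w s‖ ^ 2) ρ := by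
  refine (hF.const_mul (2 * smoothConst 𝒳 𝒴 φ lam)).mono'
    ((h.measurable_regLossGrad_right w).norm.pow_const 2).aestronglyMeasurable
    (Eventually.of_forall fun s => ?_)
  rw [Real.norm_of_nonneg (by positivity)]
  exact h.norm_sq_regLossGrad_le w s

lemma memLp_regLossGrad (h : IsSmoothLoss 𝒳 𝒴 φ lam) {w : W d}
    (hF : Integrable (fun s : 𝒳 × 𝒴 => regLoss φ lam w s) ρ) :
    MemLp (fun s => regLossGrad φ lam w s) 2 ρ :=
  (memLp_two_iff_integrable_sq_norm (h.measurable_regLossGrad_right w).aestronglyMeasurable).2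
    (h.integrable_norm_sq_regLossGrad hF)

variable [IsProbabilityMeasure ρ]

lemma integrable_regLossGrad (h : IsSmoothLoss 𝒳 𝒴 φ lam) {w : W d}
    (hF : Integrable (fun s : 𝒳 × 𝒴 => regLoss φ lam w s) ρ) :
    Integrable (fun s => regLossGrad φ lam w s) ρ :=
  (h.memLp_regLossGrad hF).integrable (by norm_num)

lemma integrable_bregman_regLoss (h : IsSmoothLoss 𝒳 𝒴 φ lam)
    (hF : ∀ w : W d, Integrable (fun s : 𝒳 × 𝒴 => regLoss φ lam w s) ρ) (v w : W d) :
    Integrable (fun s => bregman (fun w => regLoss φ lam w s) v w) ρ :=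
  ((hF v).sub (hF w)).sub ((h.integrable_regLossGrad (hF w)).const_inner (v - w))

lemma integral_bregman_regLoss (h : IsSmoothLoss 𝒳 𝒴 φ lam)
    (hF : ∀ w : W d, Integrable (fun s : 𝒳 × 𝒴 => regLoss φ lam w s) ρ) (v w : W d) :
    ∫ s, bregman (fun w => regLoss φ lam w s) v w ∂ρ =
      risk ρ φ lam v - risk ρ φ lam w - inner ℝ (v - w) (∫ s, regLossGrad φ lam w s ∂ρ) := by
  have h1 := h.integrable_regLossGrad (hF w)
  have h2 : Integrable (fun s => regLoss φ lam v s - regLoss φ lam w s) ρ := (hF v).sub (hF w)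
  rw [risk, risk, ← integral_inner h1, ← integral_sub (hF v) (hF w),
    ← integral_sub h2 (h1.const_inner (v - w))]
  rfl

lemma le_integral_bregman_regLoss (h : IsSmoothLoss 𝒳 𝒴 φ lam)
    (hF : ∀ w : W d, Integrable (fun s : 𝒳 × 𝒴 => regLoss φ lam w s) ρ) (v w : W d) :
    lam * ‖v - w‖ ^ 2 ≤ ∫ s, bregman (fun w => regLoss φ lam w s) v w ∂ρ := by
  have := integral_mono (integrable_const (lam * ‖v - w‖ ^ 2))
    (h.integrable_bregman_regLoss hF v w) fun s => h.le_bregman_regLoss v w s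
  simpa using this

lemma integral_bregman_regLoss_le (h : IsSmoothLoss 𝒳 𝒴 φ lam)
    (hF : ∀ w : W d, Integrable (fun s : 𝒳 × 𝒴 => regLoss φ lam w s) ρ) (v w : W d) :
    ∫ s, bregman (fun w => regLoss φ lam w s) v w ∂ρ ≤
      smoothConst 𝒳 𝒴 φ lam / 2 * ‖v - w‖ ^ 2 := by
  have := integral_mono (h.integrable_bregman_regLoss hF v w)
    (integrable_const (smoothConst 𝒳 𝒴 φ lam / 2 * ‖v - w‖ ^ 2))
    fun s => h.bregman_regLoss_le v w s
  simpa using this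

/-- No differentiation under the integral is needed: the integrated Bregman remainder lies between 0
and a multiple of ‖v - w‖². -/
lemma hasGradientAt_risk (h : IsSmoothLoss 𝒳 𝒴 φ lam)
    (hF : ∀ w : W d, Integrable (fun s : 𝒳 × 𝒴 => regLoss φ lam w s) ρ) (w : W d) :
    HasGradientAt (risk ρ φ lam) (∫ s, regLossGrad φ lam w s ∂ρ) w := by
  refine hasGradientAt_of_abs_sub_le (C := smoothConst 𝒳 𝒴 φ lam / 2) fun v => ?_
  have h1 := h.le_integral_bregman_regLoss hF v w
  have h2 := h.integral_bregman_regLoss_le hF v w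
  rw [h.integral_bregman_regLoss hF] at h1 h2
  have h3 : 0 ≤ lam * ‖v - w‖ ^ 2 := by have := h.lam_pos; positivity
  rwa [abs_of_nonneg (h3.trans h1)]

lemma bregman_risk (h : IsSmoothLoss 𝒳 𝒴 φ lam)
    (hF : ∀ w : W d, Integrable (fun s : 𝒳 × 𝒴 => regLoss φ lam w s) ρ) (v w : W d) :
    bregman (risk ρ φ lam) v w = ∫ s, bregman (fun w => regLoss φ lam w s) v w ∂ρ := by
  rw [h.integral_bregman_regLoss hF, bregman, (h.hasGradientAt_risk hF w).gradient]

lemma stronglySmoothWith_risk (h : IsSmoothLoss 𝒳 𝒴 φ lam)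
    (hF : ∀ w : W d, Integrable (fun s : 𝒳 × 𝒴 => regLoss φ lam w s) ρ) :
    StronglySmoothWith (risk ρ φ lam) (smoothConst 𝒳 𝒴 φ lam) :=
  ⟨fun w => (h.hasGradientAt_risk hF w).differentiableAt, fun v w => by
    rw [h.bregman_risk hF]
    exact h.integral_bregman_regLoss_le hF v w⟩

lemma stronglyConvexWith_risk (h : IsSmoothLoss 𝒳 𝒴 φ lam)
    (hF : ∀ w : W d, Integrable (fun s : 𝒳 × 𝒴 => regLoss φ lam w s) ρ) :
    StronglyConvexWith (risk ρ φ lam) (2 * lam) :=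
  ⟨fun w => (h.hasGradientAt_risk hF w).differentiableAt, fun v w => by
    rw [h.bregman_risk hF]
    simpa using h.le_integral_bregman_regLoss hF v w⟩

lemma integral_regLossGrad_eq_zero (h : IsSmoothLoss 𝒳 𝒴 φ lam)
    (hF : ∀ w : W d, Integrable (fun s : 𝒳 × 𝒴 => regLoss φ lam w s) ρ) {wstar : W d}
    (hmin : ∀ w, risk ρ φ lam wstar ≤ risk ρ φ lam w) :
    ∫ s, regLossGrad φ lam wstar s ∂ρ = 0 := by
  have h1 : IsLocalMin (risk ρ φ lam) wstar := Eventually.of_forall hmin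
  have h2 := h1.hasFDerivAt_eq_zero (h.hasGradientAt_risk hF wstar).hasFDerivAt
  simpa using h2

end Risk

end IsSmoothLoss

/-- A stochastic gradient oracle `G` that is strongly monotone and cocoercive, has a finite variance
at `a` and is centered there. -/
structure IsStochasticGradient {d : ℕ} {S : Type*} [MeasurableSpace S] (ρ : Measure S)
    (G : W d → S → W d) (μ L : ℝ) (a : W d) : Prop where
  mu_pos : 0 < μ
  L_pos : 0 < L
  measurable : Measurable (Function.uncurry G)
  le_inner : ∀ v w s, μ * ‖v - w‖ ^ 2 ≤ inner ℝ (v - w) (G v s - G w s)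
  inner_le : ∀ v w s, inner ℝ (v - w) (G v s - G w s) ≤ L * ‖v - w‖ ^ 2
  norm_sq_le : ∀ v w s, ‖G v s - G w s‖ ^ 2 ≤ L * inner ℝ (v - w) (G v s - G w s)
  integrable_norm_sq : Integrable (fun s => ‖G a s‖ ^ 2) ρ
  integral_eq_zero : ∫ s, G a s ∂ρ = 0

lemma IsSmoothLoss.isStochasticGradient {d : ℕ} {𝒳 : Set (W d)} {𝒴 : Set ℝ} {φ : ℝ → ℝ → ℝ}
    {lam : ℝ} (h : IsSmoothLoss 𝒳 𝒴 φ lam) {ρ : Measure (𝒳 × 𝒴)} [IsProbabilityMeasure ρ]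
    (hF : ∀ w : W d, Integrable (fun s : 𝒳 × 𝒴 => regLoss φ lam w s) ρ) {wstar : W d}
    (hmin : ∀ w, risk ρ φ lam wstar ≤ risk ρ φ lam w) :
    IsStochasticGradient ρ (regLossGrad φ lam) (2 * lam) (smoothConst 𝒳 𝒴 φ lam) wstar where
  mu_pos := by linarith [h.lam_pos]
  L_pos := h.smoothConst_pos
  measurable := h.measurable_regLossGrad
  le_inner v w s := (h.stronglyConvexWith_regLoss s).le_inner_gradient_sub v w
  inner_le v w s := (h.stronglySmoothWith_regLoss s).inner_gradient_sub_le v w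
  norm_sq_le v w s := (h.stronglySmoothWith_regLoss s).norm_sq_gradient_sub_le_inner
    h.smoothConst_pos
    ((h.stronglyConvexWith_regLoss s).bregman_nonneg (by linarith [h.lam_pos])) v w
  integrable_norm_sq := h.integrable_norm_sq_regLossGrad (hF wstar)
  integral_eq_zero := h.integral_regLossGrad_eq_zero hF hmin

/-! ### Scalar recursions -/

section Sequences

/-- Staying above 2δ would cost more than the initial value because the steps are not summable, so
the sequence falls below 2δ. From there one step reaches at most 3δ, and above 2δ it does not
increase. -/
lemma tendsto_zero_of_decrease {x η : ℕ → ℝ} (hx : ∀ n, 0 ≤ x n) (hη : ∀ n, 0 ≤ η n)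
    (hdiv : ¬ Summable η)
    (h : ∀ δ : ℝ, 0 < δ → ∃ c : ℝ, 0 < c ∧ ∀ᶠ n in atTop,
      (2 * δ ≤ x n → x (n + 1) ≤ x n - c * η n) ∧ (x n < 2 * δ → x (n + 1) ≤ 3 * δ)) :
    Tendsto x atTop (𝓝 0) := by
  rw [Metric.tendsto_atTop]
  intro ε hε
  obtain ⟨c, hc, hN⟩ := h (ε / 4) (by positivity)
  obtain ⟨N, hN⟩ := eventually_atTop.1 hN
  have h1 : ∃ m ≥ N, x m < 2 * (ε / 4) := by
    by_contra hcon
    push Not at hcon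
    refine hdiv ((summable_nat_add_iff N).1 (summable_of_sum_range_le (c := x N / c)
      (fun n => hη _) fun k => ?_))
    have h2 : ∀ k, x (N + k) ≤ x N - c * ∑ i ∈ Finset.range k, η (i + N) := by
      intro k
      induction k with
      | zero => simp
      | succ k ih =>
        have := (hN (N + k) (by omega)).1 (hcon _ (by omega))
        rw [Finset.sum_range_succ, add_comm k N]
        rw [← add_assoc]
        linarith
    rw [le_div_iff₀ hc]
    linarith [h2 k, hx (N + k)]
  obtain ⟨m, hm, hxm⟩ := h1
  have h3 : ∀ k, x (m + k) ≤ 3 * (ε / 4) := by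
    intro k
    induction k with
    | zero => rw [add_zero]; linarith
    | succ k ih =>
      rw [← add_assoc]
      rcases lt_or_ge (x (m + k)) (2 * (ε / 4)) with h4 | h4
      · exact (hN (m + k) (by omega)).2 h4
      · have := (hN (m + k) (by omega)).1 h4
        have := mul_nonneg hc.le (hη (m + k))
        linarith
  refine ⟨m, fun n hn => ?_⟩
  obtain ⟨k, rfl⟩ := Nat.exists_eq_add_of_le hn
  rw [Real.dist_eq, sub_zero, abs_of_nonneg (hx _)]
  linarith [h3 k]

lemma tendsto_zero_of_recursion {x e r η : ℕ → ℝ} {c : ℝ} (hc : 0 < c) (hx : ∀ n, 0 ≤ x n)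
    (he : ∀ n, 0 ≤ e n) (hη : ∀ n, 0 ≤ η n) (hdiv : ¬ Summable η)
    (hr : Tendsto r atTop (𝓝 0)) (hrη : Tendsto (fun n => r n * η n) atTop (𝓝 0))
    (hxe : ∀ δ : ℝ, 0 < δ → ∃ K : ℝ, 0 < K ∧ ∀ n, x n ≤ δ + K * e n)
    (h : ∀ᶠ n in atTop, x (n + 1) ≤ x n - c * η n * e n + r n * η n) :
    Tendsto x atTop (𝓝 0) := by
  refine tendsto_zero_of_decrease hx hη hdiv fun δ hδ => ?_
  obtain ⟨K, hK, hKe⟩ := hxe δ hδ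
  -- Above 2δ one has `e n ≥ δ / K`, hence a drift of `c * δ / K` per unit step; half of it absorbs
  -- `r n`.
  refine ⟨c * δ / K / 2, by positivity, ?_⟩
  filter_upwards [h, hr.eventually (gt_mem_nhds (show 0 < c * δ / K / 2 by positivity)),
    hrη.eventually (gt_mem_nhds hδ)] with n h1 h2 h3
  constructor
  · intro h4
    have h5 : δ / K ≤ e n := by
      rw [div_le_iff₀ hK]
      linarith [hKe n]
    have h6 : c * η n * (δ / K) ≤ c * η n * e n :=
      mul_le_mul_of_nonneg_left h5 (mul_nonneg hc.le (hη n))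
    have h7 : r n * η n ≤ c * δ / K / 2 * η n := mul_le_mul_of_nonneg_right h2.le (hη n)
    have h8 : c * η n * (δ / K) = 2 * (c * δ / K / 2 * η n) := by ring
    linarith
  · intro h4
    have := mul_nonneg (mul_nonneg hc.le (hη n)) (he n)
    linarith

/-- For 0 ≤ u ≤ q < 1 one has 1 - u ≥ exp(-u/(1-q)), so the product of the factors stays above the
exponential of a convergent sum. -/
lemma exists_pos_le_of_summable {y η : ℕ → ℝ} {a q : ℝ} {N : ℕ} (ha : 0 ≤ a)
    (hη : ∀ n, 0 ≤ η n) (hs : Summable η) (hq : q < 1) (haq : ∀ n, N ≤ n → a * η n ≤ q)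
    (hN : 0 < y N) (h : ∀ n, N ≤ n → (1 - a * η n) * y n ≤ y (n + 1)) :
    ∃ c : ℝ, 0 < c ∧ ∀ n, N ≤ n → c ≤ y n := by
  have hq' : 0 < 1 - q := by linarith
  have h1 : ∀ k, y N * Real.exp (-(a / (1 - q) * ∑ i ∈ Finset.range k, η (i + N)))
      ≤ y (N + k) := by
    intro k
    induction k with
    | zero => simp
    | succ k ih =>
      have h2 := h (N + k) (by omega)
      have h3 := haq (N + k) (by omega)
      set u := a * η (N + k) with hu
      have hu0 : 0 ≤ u := mul_nonneg ha (hη _)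
      have h4 : Real.exp (-(u / (1 - q))) ≤ 1 - u := by
        rw [Real.exp_neg, inv_le_comm₀ (Real.exp_pos _) (by linarith)]
        refine le_trans ?_ (Real.add_one_le_exp _)
        have h5 : u / (1 - u) ≤ u / (1 - q) := by gcongr
        have h6 : (1 - u)⁻¹ = u / (1 - u) + 1 := by
          have : (1 - u) ≠ 0 := by linarith
          field_simp
          ring
        linarith
      have h7 : 0 ≤ y (N + k) := le_trans (by positivity) ih
      rw [Finset.sum_range_succ, ← add_assoc]
      calc y N * Real.exp (-(a / (1 - q) * (∑ i ∈ Finset.range k, η (i + N) + η (k + N))))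
          = Real.exp (-(u / (1 - q))) *
            (y N * Real.exp (-(a / (1 - q) * ∑ i ∈ Finset.range k, η (i + N)))) := by
            rw [hu, add_comm k N, mul_left_comm, ← Real.exp_add]
            congr 2
            ring
        _ ≤ (1 - u) * y (N + k) := by gcongr; linarith
        _ ≤ _ := h2
  have hs' : Summable fun i => η (i + N) := (summable_nat_add_iff N).2 hs
  refine ⟨y N * Real.exp (-(a / (1 - q) * ∑' i, η (i + N))), by positivity, fun n hn => ?_⟩
  obtain ⟨k, rfl⟩ := Nat.exists_eq_add_of_le hn
  refine le_trans ?_ (h1 k)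
  gcongr
  exact hs'.sum_le_tsum _ fun i _ => hη _

/-- Whatever the step is, bη² - aηC/n ≥ -(aC/n)²/(4b). The choice Ca² ≤ 2b keeps this loss within
C/n - C/(n+1). -/
lemma exists_div_le_of_recursion {y η : ℕ → ℝ} {a b : ℝ} {N : ℕ} (ha : 0 < a) (hb : 0 < b)
    (hN1 : 1 ≤ N) (haη : ∀ n, N ≤ n → a * η n ≤ 1) (hN : 0 < y N)
    (h : ∀ n, N ≤ n → (1 - a * η n) * y n + b * η n ^ 2 ≤ y (n + 1)) :
    ∃ C : ℝ, 0 < C ∧ ∀ n : ℕ, N ≤ n → C / n ≤ y n := by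
  refine ⟨min (y N * N) (2 * b / a ^ 2), lt_min (by positivity) (by positivity), ?_⟩
  set C := min (y N * N) (2 * b / a ^ 2) with hC
  have hC0 : 0 < C := lt_min (by positivity) (by positivity)
  have hC2 : C * a ^ 2 ≤ 2 * b := by
    rw [← le_div_iff₀ (by positivity)]
    exact min_le_right _ _
  intro n hn
  induction n, hn using Nat.le_induction with
  | base =>
    rw [div_le_iff₀ (by positivity)]
    exact min_le_left _ _
  | succ n hn ih =>
    have hn1 : (1 : ℝ) ≤ n := by exact_mod_cast hN1.trans hn
    refine le_trans ?_ (h n hn)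
    have h1 : (1 - a * η n) * (C / n) ≤ (1 - a * η n) * y n :=
      mul_le_mul_of_nonneg_left ih (by linarith [haη n hn])
    refine le_trans ?_ (add_le_add h1 le_rfl)
    have h2 : C / n - C / (n + 1) = C / (n * (n + 1)) := by
      field_simp
      ring
    have h3 : (a * (C / n)) ^ 2 / (4 * b) ≤ C / (n * (n + 1)) := by
      have h4 : (a * (C / n)) ^ 2 / (4 * b) = C / (n * (n + 1)) * (C * a ^ 2 / (2 * b)) *
          ((n + 1) / (2 * n)) := by
        field_simp
        ring
      rw [h4]
      have h5 : C * a ^ 2 / (2 * b) ≤ 1 := by rwa [div_le_one (by positivity)]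
      have h6 : ((n : ℝ) + 1) / (2 * n) ≤ 1 := by
        rw [div_le_one (by positivity)]; linarith
      have h7 : 0 ≤ C / (n * ((n : ℝ) + 1)) := by positivity
      calc C / (n * ((n : ℝ) + 1)) * (C * a ^ 2 / (2 * b)) * ((n + 1) / (2 * n))
          ≤ C / (n * ((n : ℝ) + 1)) * 1 * 1 := by gcongr
        _ = _ := by ring
    have h4 : 0 ≤ (a * (C / n)) ^ 2 / (4 * b) - a * η n * (C / n) + b * η n ^ 2 := by
      have : (a * (C / n)) ^ 2 / (4 * b) - a * η n * (C / n) + b * η n ^ 2 =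
          (a * (C / n) - 2 * b * η n) ^ 2 / (4 * b) := by
        field_simp
        ring
      rw [this]
      positivity
    push_cast
    linarith

/-- With the ansatz K/(n+1), the induction step has the exact slack K/((n+1)(n+2)²) once K ≥ C. -/
lemma exists_le_div_of_recursion {y : ℕ → ℝ} {C : ℝ} {N : ℕ}
    (h : ∀ n : ℕ, N ≤ n → y (n + 1) ≤ (1 - 2 / ((n : ℝ) + 2)) * y n + C / ((n : ℝ) + 2) ^ 2) :
    ∃ K : ℝ, ∀ n : ℕ, N ≤ n → y n ≤ K / (n + 1) := by
  set K := max (max C 0) (y N * (N + 1)) with hK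
  have hKC : C ≤ K := (le_max_left _ _).trans (le_max_left _ _)
  have hK0 : 0 ≤ K := (le_max_right _ _).trans (le_max_left _ _)
  refine ⟨K, fun n hn => ?_⟩
  induction n, hn using Nat.le_induction with
  | base =>
    rw [le_div_iff₀ (by positivity)]
    exact le_max_right _ _
  | succ n hn ih =>
    have h1 : (0 : ℝ) ≤ 1 - 2 / ((n : ℝ) + 2) := by
      rw [sub_nonneg, div_le_one (by positivity)]
      linarith [(Nat.cast_nonneg n : (0 : ℝ) ≤ n)]
    refine (h n hn).trans ((add_le_add (mul_le_mul_of_nonneg_left ih h1) le_rfl).trans ?_)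
    have h2 : C / ((n : ℝ) + 2) ^ 2 ≤ K / ((n : ℝ) + 2) ^ 2 := by gcongr
    refine (add_le_add le_rfl h2).trans ?_
    push_cast
    have h3 : K / ((n : ℝ) + 1 + 1) - ((1 - 2 / ((n : ℝ) + 2)) * (K / (n + 1))
        + K / ((n : ℝ) + 2) ^ 2) = K / (((n : ℝ) + 1) * (n + 2) ^ 2) := by
      have : (n : ℝ) + 1 + 1 = n + 2 := by ring
      rw [this]
      field_simp
      ring
    have h4 : 0 ≤ K / (((n : ℝ) + 1) * (n + 2) ^ 2) := by positivity
    linarith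

lemma sumDiverges_iff {η : ℕ → ℝ} (hη : ∀ t, 1 ≤ t → 0 < η t) :
    SumDiverges η ↔ ¬ Summable (fun n => η (n + 1)) := by
  rw [not_summable_iff_tendsto_nat_atTop_of_nonneg fun n => (hη _ (by omega)).le, SumDiverges]
  refine iff_of_eq (congrArg (fun f => Tendsto f atTop atTop) (funext fun n => ?_))
  rw [Finset.range_eq_Ico, Finset.sum_Ico_add' (fun t => η t) 0 n 1]
  rfl

end Sequences

/-! ### Inverting the mirror map -/

section MirrorMap

variable {d : ℕ} {Ψ : W d → ℝ} {σ : ℝ}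

lemma StronglyConvexWith.continuous_gradient (hσ : 0 < σ) (hΨ : StronglyConvexWith Ψ σ) :
    Continuous (gradient Ψ) :=
  continuous_iff_continuousAt.2 fun a =>
    tendsto_gradient_of_bregman_nonneg hΨ.1 (hΨ.bregman_nonneg hσ.le) a

/-- The gradient of a strongly convex function has a continuous left inverse. -/
lemma StronglyConvexWith.exists_continuous_leftInverse (hσ : 0 < σ)
    (hΨ : StronglyConvexWith Ψ σ) :
    ∃ h : W d → W d, Continuous h ∧ ∀ w, h (gradient Ψ w) = w := by
  have hinj : Function.Injective (gradient Ψ) := fun v w hvw => by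
    have h1 := hΨ.le_norm_gradient_sub v w
    rw [hvw, sub_self, norm_zero] at h1
    have h2 : ‖v - w‖ = 0 := le_antisymm (by nlinarith) (norm_nonneg _)
    exact sub_eq_zero.1 (norm_eq_zero.1 h2)
  have hinv := Function.leftInverse_invFun hinj
  have hlip : LipschitzOnWith (Real.toNNReal σ⁻¹) (Function.invFun (gradient Ψ))
      (Set.range (gradient Ψ)) := by
    refine LipschitzOnWith.of_dist_le_mul ?_
    rintro _ ⟨v, rfl⟩ _ ⟨w, rfl⟩
    rw [hinv, hinv, dist_eq_norm, dist_eq_norm, Real.coe_toNNReal _ (by positivity),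
      ← div_eq_inv_mul, le_div_iff₀ hσ, mul_comm]
    exact hΨ.le_norm_gradient_sub v w
  -- Extending the Lipschitz inverse off the range avoids proving that the gradient is surjective.
  obtain ⟨h, hh, heq⟩ := hlip.extend_finite_dimension
  exact ⟨h, hh.continuous, fun w => by rw [← heq ⟨w, rfl⟩, hinv]⟩

lemma StronglyConvexWith.continuous_bregman_right (hσ : 0 < σ) (hΨ : StronglyConvexWith Ψ σ)
    (a : W d) : Continuous (bregman Ψ a) := by
  have h1 := hΨ.continuous_gradient hσ
  have h2 := hΨ.1.continuous
  unfold bregman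
  fun_prop

end MirrorMap

/-- The iterates `w₀ = w₁, w₁, …` of stochastic mirror descent with mirror map `Ψ`, along independent
samples `z₀, z₁, …` of law `ρ`, with gradient oracle `G` and step sizes `η₀, η₁, …`. -/
structure IsMirrorDescent {d : ℕ} {S Ω : Type*} [MeasurableSpace S] [MeasurableSpace Ω]
    (P : Measure Ω) (ρ : Measure S) (G : W d → S → W d) (Ψ : W d → ℝ) (σ : ℝ) (η : ℕ → ℝ)
    (z : ℕ → Ω → S) (w₁ : W d) (w : ℕ → Ω → W d) : Prop where
  sigma_pos : 0 < σ
  stronglyConvex : StronglyConvexWith Ψ σ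
  quadraticallyBounded : QuadraticallyBounded Ψ
  eta_pos : ∀ n, 0 < η n
  measurable_sample : ∀ n, Measurable (z n)
  map_sample : ∀ n, P.map (z n) = ρ
  iIndepFun_sample : iIndepFun z P
  init : ∀ ω, w 0 ω = w₁
  step : ∀ n ω, gradient Ψ (w (n + 1) ω) = gradient Ψ (w n ω) - η n • G (w n ω) (z n ω)

/-- The information contained in the samples before time `n`. -/
def pastFiltration {S Ω : Type*} [MeasurableSpace S] [mΩ : MeasurableSpace Ω] (z : ℕ → Ω → S)
    (hz : ∀ n, Measurable (z n)) : Filtration ℕ mΩ where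
  seq n := ⨆ i ∈ Set.Iio n, MeasurableSpace.comap (z i) inferInstance
  mono' _ _ hmn := biSup_mono fun _ hi => lt_of_lt_of_le hi hmn
  le' _ := iSup₂_le fun i _ => (hz i).comap_le

namespace IsMirrorDescent

variable {d : ℕ} {S Ω : Type*} [MeasurableSpace S] [mΩ : MeasurableSpace Ω]
  {P : Measure Ω} {ρ : Measure S} {G : W d → S → W d} {Ψ : W d → ℝ} {σ : ℝ}
  {η : ℕ → ℝ} {z : ℕ → Ω → S} {w₁ : W d} {w : ℕ → Ω → W d} {μ L : ℝ} {a : W d}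

/-! ### Pathwise identities for one mirror step -/

section Pointwise

lemma bregman_nonneg (h : IsMirrorDescent P ρ G Ψ σ η z w₁ w) (u v : W d) :
    0 ≤ bregman Ψ u v :=
  h.stronglyConvex.bregman_nonneg h.sigma_pos.le u v

lemma norm_sq_le_bregman (h : IsMirrorDescent P ρ G Ψ σ η z w₁ w) (n : ℕ) (ω : Ω) :
    ‖a - w n ω‖ ^ 2 ≤ 2 / σ * bregman Ψ a (w n ω) := by
  have h1 := h.stronglyConvex.2 a (w n ω)
  have := h.sigma_pos
  rw [div_mul_eq_mul_div, le_div_iff₀ this]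
  linarith

lemma gradient_sub (h : IsMirrorDescent P ρ G Ψ σ η z w₁ w) (n : ℕ) (ω : Ω) :
    gradient Ψ (w n ω) - gradient Ψ (w (n + 1) ω) = η n • G (w n ω) (z n ω) := by
  rw [h.step n ω, sub_sub_cancel]

/-- The gradient is split at `a`: the difference carries the drift, and the value at `a` is centered
noise. -/
lemma bregman_succ (h : IsMirrorDescent P ρ G Ψ σ η z w₁ w) (n : ℕ) (ω : Ω) :
    bregman Ψ a (w (n + 1) ω) = bregman Ψ a (w n ω) + bregman Ψ (w n ω) (w (n + 1) ω)
      - η n * inner ℝ (w n ω - a) (G (w n ω) (z n ω) - G a (z n ω))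
      - η n * inner ℝ (w n ω - a) (G a (z n ω)) := by
  rw [bregman_three_point Ψ a (w n ω) (w (n + 1) ω), h.gradient_sub, real_inner_smul_right,
    ← neg_sub (w n ω) a, inner_neg_left, inner_sub_right]
  ring

lemma bregman_step_le (h : IsMirrorDescent P ρ G Ψ σ η z w₁ w) (n : ℕ) (ω : Ω) :
    bregman Ψ (w n ω) (w (n + 1) ω) ≤ η n ^ 2 / (2 * σ) * ‖G (w n ω) (z n ω)‖ ^ 2 := by
  have h1 := h.stronglyConvex.bregman_le_norm_sq_gradient_sub h.sigma_pos (w n ω) (w (n + 1) ω)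
  have := h.sigma_pos
  rw [h.gradient_sub, norm_smul, mul_pow, Real.norm_eq_abs, sq_abs] at h1
  rw [div_mul_eq_mul_div, le_div_iff₀ (by positivity)]
  linarith

lemma le_bregman_step (h : IsMirrorDescent P ρ G Ψ σ η z w₁ w) {LΨ : ℝ} (hL : 0 < LΨ)
    (hΨ : StronglySmoothWith Ψ LΨ) (n : ℕ) (ω : Ω) :
    η n ^ 2 / (2 * LΨ) * ‖G (w n ω) (z n ω)‖ ^ 2 ≤ bregman Ψ (w n ω) (w (n + 1) ω) := by
  have h1 := hΨ.norm_sq_gradient_sub_le hL h.bregman_nonneg (w n ω) (w (n + 1) ω)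
  rw [h.gradient_sub, norm_smul, mul_pow, Real.norm_eq_abs, sq_abs] at h1
  rw [div_mul_eq_mul_div, div_le_iff₀ (by positivity)]
  linarith

lemma norm_sub_succ_le (h : IsMirrorDescent P ρ G Ψ σ η z w₁ w) (n : ℕ) (ω : Ω) :
    ‖w n ω - w (n + 1) ω‖ ≤ η n / σ * ‖G (w n ω) (z n ω)‖ := by
  have h1 := h.stronglyConvex.le_norm_gradient_sub (w n ω) (w (n + 1) ω)
  rw [h.gradient_sub, norm_smul, Real.norm_of_nonneg (h.eta_pos n).le] at h1
  rw [div_mul_eq_mul_div, le_div_iff₀ h.sigma_pos]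
  linarith

end Pointwise

end IsMirrorDescent

namespace IsStochasticGradient

variable {d : ℕ} {S : Type*} [MeasurableSpace S] {ρ : Measure S} {G : W d → S → W d}
  {μ L : ℝ} {a : W d}

lemma norm_sub_le (hG : IsStochasticGradient ρ G μ L a) (v w : W d) (s : S) :
    ‖G v s - G w s‖ ≤ L * ‖v - w‖ := by
  have h1 := hG.norm_sq_le v w s
  have h2 := hG.inner_le v w s
  have h3 := hG.L_pos
  refine abs_le_of_sq_le_sq' ?_ (by positivity) |>.2
  nlinarith

lemma norm_le (hG : IsStochasticGradient ρ G μ L a) (v : W d) (s : S) :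
    ‖G v s‖ ≤ ‖G a s‖ + L * ‖a - v‖ := by
  have h1 := hG.norm_sub_le v a s
  rw [norm_sub_rev v a] at h1
  have h2 := norm_sub_norm_le (G v s) (G a s)
  linarith

lemma norm_sq_le_add (hG : IsStochasticGradient ρ G μ L a) (v : W d) (s : S) :
    ‖G v s‖ ^ 2 ≤ 2 * ‖G a s‖ ^ 2 + 2 * L ^ 2 * ‖a - v‖ ^ 2 := by
  have h1 := pow_le_pow_left₀ (norm_nonneg _) (hG.norm_le v s) 2
  nlinarith [sq_nonneg (‖G a s‖ - L * ‖a - v‖)]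

lemma measurable_right (hG : IsStochasticGradient ρ G μ L a) (v : W d) : Measurable (G v) :=
  hG.measurable.comp (f := fun s => (v, s)) measurable_prodMk_left

lemma memLp (hG : IsStochasticGradient ρ G μ L a) : MemLp (G a) 2 ρ :=
  (memLp_two_iff_integrable_sq_norm (hG.measurable_right a).aestronglyMeasurable).2
    hG.integrable_norm_sq

end IsStochasticGradient

namespace IsMirrorDescent

variable {d : ℕ} {S Ω : Type*} [MeasurableSpace S] [mΩ : MeasurableSpace Ω]
  {P : Measure Ω} {ρ : Measure S} {G : W d → S → W d} {Ψ : W d → ℝ} {σ : ℝ}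
  {η : ℕ → ℝ} {z : ℕ → Ω → S} {w₁ : W d} {w : ℕ → Ω → W d} {μ L : ℝ} {a : W d}

/-! ### Pathwise upper and lower bounds for one step -/

section Progress

lemma bregman_succ_le (h : IsMirrorDescent P ρ G Ψ σ η z w₁ w)
    (hG : IsStochasticGradient ρ G μ L a) (n : ℕ) (ω : Ω) :
    bregman Ψ a (w (n + 1) ω) ≤ bregman Ψ a (w n ω)
      - (η n * μ - η n ^ 2 * L ^ 2 / σ) * ‖a - w n ω‖ ^ 2
      - η n * inner ℝ (w n ω - a) (G a (z n ω)) + η n ^ 2 / σ * ‖G a (z n ω)‖ ^ 2 := by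
  have h1 := hG.le_inner (w n ω) a (z n ω)
  rw [norm_sub_rev] at h1
  have h2 := h.bregman_step_le n ω
  have hσ := h.sigma_pos
  have h3 := mul_le_mul_of_nonneg_left (hG.norm_sq_le_add (w n ω) (z n ω))
    (by positivity : 0 ≤ η n ^ 2 / (2 * σ))
  have h4 := mul_le_mul_of_nonneg_left h1 (h.eta_pos n).le
  have h5 : η n ^ 2 / (2 * σ) * (2 * ‖G a (z n ω)‖ ^ 2 + 2 * L ^ 2 * ‖a - w n ω‖ ^ 2) =
      η n ^ 2 / σ * ‖G a (z n ω)‖ ^ 2 + η n ^ 2 * L ^ 2 / σ * ‖a - w n ω‖ ^ 2 := by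
    field_simp
  rw [h.bregman_succ n ω]
  linarith

/-- One-step progress at a sample whose gradient vanishes at the target. -/
lemma bregman_succ_le_of_eq_zero (h : IsMirrorDescent P ρ G Ψ σ η z w₁ w)
    (hG : IsStochasticGradient ρ G μ L a) {n : ℕ} {ω : Ω} (h0 : G a (z n ω) = 0)
    (hη : η n * L ≤ σ) :
    bregman Ψ a (w (n + 1) ω) ≤ bregman Ψ a (w n ω) - μ / 2 * η n * ‖a - w n ω‖ ^ 2 := by
  have h1 := hG.le_inner (w n ω) a (z n ω)
  have h2 := h.bregman_step_le n ω
  have h3 := hG.norm_sq_le (w n ω) a (z n ω)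
  have hσ := h.sigma_pos
  have hη0 := h.eta_pos n
  have hμ := hG.mu_pos
  rw [h.bregman_succ n ω, h0, inner_zero_right]
  rw [h0, sub_zero] at h1 h3
  rw [norm_sub_rev] at h1
  rw [sub_zero]
  set q := inner ℝ (w n ω - a) (G (w n ω) (z n ω))
  have hq : 0 ≤ q := le_trans (by positivity) h1
  -- Cocoercivity bounds the squared gradient by `L * q`, so half of the drift `η n * q` pays for
  -- the step.
  have h4 : η n ^ 2 / (2 * σ) * ‖G (w n ω) (z n ω)‖ ^ 2 ≤ η n / 2 * q := by
    calc η n ^ 2 / (2 * σ) * ‖G (w n ω) (z n ω)‖ ^ 2 ≤ η n ^ 2 / (2 * σ) * (L * q) := by gcongr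
      _ = η n / 2 * q * (η n * L / σ) := by field_simp
      _ ≤ η n / 2 * q * 1 := by
        gcongr
        rwa [div_le_one hσ]
      _ = _ := mul_one _
  have h5 := mul_le_mul_of_nonneg_left h1 hη0.le
  linarith

lemma le_bregman_succ (h : IsMirrorDescent P ρ G Ψ σ η z w₁ w)
    (hG : IsStochasticGradient ρ G μ L a) (n : ℕ) (ω : Ω) :
    bregman Ψ a (w n ω) - η n * L * ‖a - w n ω‖ ^ 2
      - η n * inner ℝ (w n ω - a) (G a (z n ω)) + bregman Ψ (w n ω) (w (n + 1) ω)
      ≤ bregman Ψ a (w (n + 1) ω) := by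
  have h1 := hG.inner_le (w n ω) a (z n ω)
  rw [norm_sub_rev] at h1
  have h4 := mul_le_mul_of_nonneg_left h1 (h.eta_pos n).le
  rw [h.bregman_succ (a := a) n ω]
  linarith

end Progress

/-! ### Adaptedness and independence -/

section Measurability

/-- The recursion prescribes only the gradient of Ψ at the next iterate; the continuous left inverse
turns it into a measurable function of the past and the current sample. -/
lemma measurable_past (h : IsMirrorDescent P ρ G Ψ σ η z w₁ w)
    (hG : IsStochasticGradient ρ G μ L a) (n : ℕ) :
    Measurable[pastFiltration z h.measurable_sample n] (w n) := by
  obtain ⟨i, hi, hinv⟩ := h.stronglyConvex.exists_continuous_leftInverse h.sigma_pos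
  have hgrad := (h.stronglyConvex.continuous_gradient h.sigma_pos).measurable
  induction n with
  | zero =>
    have : w 0 = fun _ => w₁ := funext h.init
    rw [this]
    exact @measurable_const _ _ _ (pastFiltration z h.measurable_sample 0) _
  | succ n ih =>
    set ℱ := pastFiltration z h.measurable_sample with hℱ
    have h1 : Measurable[ℱ (n + 1)] (w n) := ih.mono (ℱ.mono (Nat.le_succ n)) le_rfl
    have h2 : Measurable[ℱ (n + 1)] (z n) := by
      rw [measurable_iff_comap_le]
      exact le_iSup₂_of_le (f := fun i (_ : i ∈ Set.Iio (n + 1)) =>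
        MeasurableSpace.comap (z i) inferInstance) n (Nat.lt_succ_self n) le_rfl
    have h3 : w (n + 1) = fun ω => i (gradient Ψ (w n ω) - η n • G (w n ω) (z n ω)) := by
      funext ω
      rw [← h.step n ω, hinv]
    rw [h3]
    have h4 : Measurable[ℱ (n + 1)] fun ω => G (w n ω) (z n ω) :=
      hG.measurable.comp (h1.prodMk h2)
    exact hi.measurable.comp ((hgrad.comp h1).sub (h4.const_smul (η n)))

lemma measurable (h : IsMirrorDescent P ρ G Ψ σ η z w₁ w)
    (hG : IsStochasticGradient ρ G μ L a) (n : ℕ) : Measurable (w n) :=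
  (h.measurable_past hG n).mono ((pastFiltration z h.measurable_sample).le n) le_rfl

lemma measurable_gradient_oracle (h : IsMirrorDescent P ρ G Ψ σ η z w₁ w)
    (hG : IsStochasticGradient ρ G μ L a) (n : ℕ) :
    Measurable fun ω => G (w n ω) (z n ω) :=
  hG.measurable.comp ((h.measurable hG n).prodMk (h.measurable_sample n))

lemma indep_past (h : IsMirrorDescent P ρ G Ψ σ η z w₁ w) (n : ℕ) :
    Indep (pastFiltration z h.measurable_sample n)
      (MeasurableSpace.comap (z n) inferInstance) P := by
  have h1 := indep_iSup_of_disjoint (S := Set.Iio n) (T := {n})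
    (fun i => (h.measurable_sample i).comap_le) h.iIndepFun_sample.iIndep
    (by simp)
  simp only [Set.mem_singleton_iff, iSup_iSup_eq_left] at h1
  exact h1

lemma indepFun_past (h : IsMirrorDescent P ρ G Ψ σ η z w₁ w) {E : Type*} [MeasurableSpace E]
    {n : ℕ} {X : Ω → E} (hX : Measurable[pastFiltration z h.measurable_sample n] X) :
    X ⟂ᵢ[P] (z n) := by
  rw [IndepFun_iff_Indep]
  exact indep_of_indep_of_le_left (h.indep_past n) hX.comap_le

end Measurability

/-! ### Moments of the iterates and of the noise -/

section Integrability

lemma memLp_target (h : IsMirrorDescent P ρ G Ψ σ η z w₁ w)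
    (hG : IsStochasticGradient ρ G μ L a) (n : ℕ) : MemLp (fun ω => G a (z n ω)) 2 P := by
  have h1 := hG.memLp
  rw [← h.map_sample n] at h1
  exact h1.comp_of_map (h.measurable_sample n).aemeasurable

lemma integrable_target_sq (h : IsMirrorDescent P ρ G Ψ σ η z w₁ w)
    (hG : IsStochasticGradient ρ G μ L a) (n : ℕ) :
    Integrable (fun ω => ‖G a (z n ω)‖ ^ 2) P :=
  (h.memLp_target hG n).integrable_norm_pow (p := 2) (by norm_num)

lemma exists_bregman_le (h : IsMirrorDescent P ρ G Ψ σ η z w₁ w) (a : W d) {δ : ℝ} (hδ : 0 < δ) :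
    ∃ C : ℝ, 0 < C ∧ ∀ v, bregman Ψ a v ≤ δ + C * ‖a - v‖ ^ 2 :=
  h.quadraticallyBounded.exists_bregman_le h.stronglyConvex.1 h.bregman_nonneg a hδ

lemma stronglyMeasurable_bregman (h : IsMirrorDescent P ρ G Ψ σ η z w₁ w)
    (hG : IsStochasticGradient ρ G μ L a) (n : ℕ) :
    StronglyMeasurable[pastFiltration z h.measurable_sample n] fun ω => bregman Ψ a (w n ω) :=
  ((h.stronglyConvex.continuous_bregman_right h.sigma_pos a).measurable.comp
    (h.measurable_past hG n)).stronglyMeasurable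

variable [IsProbabilityMeasure P]

lemma memLp_sub (h : IsMirrorDescent P ρ G Ψ σ η z w₁ w)
    (hG : IsStochasticGradient ρ G μ L a) (n : ℕ) : MemLp (fun ω => a - w n ω) 2 P := by
  induction n with
  | zero =>
    have : w 0 = fun _ => w₁ := funext h.init
    rw [this]
    exact memLp_const _
  | succ n ih =>
    have h1 := ih.norm.add (((h.memLp_target hG n).norm.add (ih.norm.const_mul L)).const_mul
      (η n / σ))
    refine h1.mono' ((h.measurable hG (n + 1)).const_sub a).aestronglyMeasurable
      (Eventually.of_forall fun ω => ?_)
    have h2 := h.norm_sub_succ_le n ω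
    have h3 := hG.norm_le (w n ω) (z n ω)
    have h4 := mul_le_mul_of_nonneg_left h3 (div_pos (h.eta_pos n) h.sigma_pos).le
    have h5 := norm_add_le (a - w n ω) (w n ω - w (n + 1) ω)
    rw [sub_add_sub_cancel] at h5
    exact h5.trans (add_le_add le_rfl (h2.trans h4))

lemma memLp_gradient_oracle (h : IsMirrorDescent P ρ G Ψ σ η z w₁ w)
    (hG : IsStochasticGradient ρ G μ L a) (n : ℕ) :
    MemLp (fun ω => G (w n ω) (z n ω)) 2 P :=
  ((h.memLp_target hG n).norm.add ((h.memLp_sub hG n).norm.const_mul L)).mono'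
    (h.measurable_gradient_oracle hG n).aestronglyMeasurable
    (Eventually.of_forall fun ω => hG.norm_le (w n ω) (z n ω))

lemma integrable_sq (h : IsMirrorDescent P ρ G Ψ σ η z w₁ w)
    (hG : IsStochasticGradient ρ G μ L a) (n : ℕ) :
    Integrable (fun ω => ‖a - w n ω‖ ^ 2) P :=
  (h.memLp_sub hG n).integrable_norm_pow (p := 2) (by norm_num)

lemma integrable_gradient_oracle_sq (h : IsMirrorDescent P ρ G Ψ σ η z w₁ w)
    (hG : IsStochasticGradient ρ G μ L a) (n : ℕ) :
    Integrable (fun ω => ‖G (w n ω) (z n ω)‖ ^ 2) P :=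
  (h.memLp_gradient_oracle hG n).integrable_norm_pow (p := 2) (by norm_num)

lemma integrable_bregman (h : IsMirrorDescent P ρ G Ψ σ η z w₁ w)
    (hG : IsStochasticGradient ρ G μ L a) (n : ℕ) :
    Integrable (fun ω => bregman Ψ a (w n ω)) P := by
  obtain ⟨C, -, hC⟩ := h.exists_bregman_le a one_pos
  refine ((integrable_const (1 : ℝ)).add ((h.integrable_sq hG n).const_mul C)).mono'
    ((h.stronglyConvex.continuous_bregman_right h.sigma_pos a).measurable.comp
      (h.measurable hG n)).aestronglyMeasurable (Eventually.of_forall fun ω => ?_)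
  rw [Real.norm_of_nonneg (h.bregman_nonneg _ _)]
  exact hC _

lemma integrable_bregman_step (h : IsMirrorDescent P ρ G Ψ σ η z w₁ w)
    (hG : IsStochasticGradient ρ G μ L a) (n : ℕ) :
    Integrable (fun ω => bregman Ψ (w n ω) (w (n + 1) ω)) P := by
  refine ((h.integrable_gradient_oracle_sq hG n).const_mul (η n ^ 2 / (2 * σ))).mono' ?_
    (Eventually.of_forall fun ω => ?_)
  · have h1 := (h.stronglyConvex.continuous_gradient h.sigma_pos).measurable
    have h2 := h.stronglyConvex.1.continuous.measurable
    have h3 := h.measurable hG n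
    have h4 := h.measurable hG (n + 1)
    exact (((h2.comp h3).sub (h2.comp h4)).sub
      ((h3.sub h4).inner (h1.comp h4))).aestronglyMeasurable
  · rw [Real.norm_of_nonneg (h.bregman_nonneg _ _)]
    exact h.bregman_step_le n ω

lemma integrable_inner_target (h : IsMirrorDescent P ρ G Ψ σ η z w₁ w)
    (hG : IsStochasticGradient ρ G μ L a) (n : ℕ) :
    Integrable (fun ω => inner ℝ (w n ω - a) (G a (z n ω))) P := by
  refine ((h.integrable_sq hG n).add (h.integrable_target_sq hG n)).mono'
    (((h.measurable hG n).sub_const a).inner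
      ((hG.measurable_right a).comp (h.measurable_sample n))).aestronglyMeasurable
    (Eventually.of_forall fun ω => ?_)
  have h1 := norm_inner_le_norm (𝕜 := ℝ) (w n ω - a) (G a (z n ω))
  rw [norm_sub_rev (w n ω)] at h1
  change _ ≤ ‖a - w n ω‖ ^ 2 + ‖G a (z n ω)‖ ^ 2
  nlinarith [sq_nonneg (‖a - w n ω‖ - ‖G a (z n ω)‖), sq_nonneg (‖a - w n ω‖),
    sq_nonneg (‖G a (z n ω)‖)]

/-- The indicator of `A` times w_n - a depends on the past alone, so it is independent of the
centered vector G(a, z_n). Stating this on past events serves both the mean recursions and the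
supermartingale property. -/
lemma setIntegral_inner_target (h : IsMirrorDescent P ρ G Ψ σ η z w₁ w)
    (hG : IsStochasticGradient ρ G μ L a) {n : ℕ} {A : Set Ω}
    (hA : MeasurableSet[pastFiltration z h.measurable_sample n] A) :
    ∫ ω in A, inner ℝ (w n ω - a) (G a (z n ω)) ∂P = 0 := by
  have hA' := (pastFiltration z h.measurable_sample).le n A hA
  have h1 : Measurable[pastFiltration z h.measurable_sample n]
      (A.indicator fun ω => w n ω - a) :=
    ((h.measurable_past hG n).sub_const a).indicator hA
  have h2 := (h.indepFun_past h1).comp measurable_id (hG.measurable_right a)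
  have h3 : Integrable (A.indicator fun ω => w n ω - a) P := by
    refine Integrable.indicator ?_ hA'
    have := ((h.memLp_sub hG n).integrable (by norm_num)).neg
    simpa [Pi.neg_def] using this
  have h4 := h2.integral_bilin (h3 : Integrable (id ∘ _) P)
    ((h.memLp_target hG n).integrable (by norm_num)) (innerSL ℝ)
  have h5 : ∫ ω, (G a ∘ z n) ω ∂P = 0 := by
    rw [← hG.integral_eq_zero, ← h.map_sample n, integral_map
      (h.measurable_sample n).aemeasurable (hG.measurable_right a).aestronglyMeasurable]
    rfl
  rw [h5, map_zero] at h4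
  rw [← integral_indicator hA', ← h4]
  refine integral_congr_ae (Eventually.of_forall fun ω => ?_)
  by_cases hω : ω ∈ A
  · simp only [Function.comp_apply, Set.indicator_of_mem hω, id_eq]
    rfl
  · simp [hω]

lemma integral_inner_target (h : IsMirrorDescent P ρ G Ψ σ η z w₁ w)
    (hG : IsStochasticGradient ρ G μ L a) (n : ℕ) :
    ∫ ω, inner ℝ (w n ω - a) (G a (z n ω)) ∂P = 0 := by
  simpa using h.setIntegral_inner_target hG (n := n) MeasurableSet.univ

lemma setIntegral_target_sq (h : IsMirrorDescent P ρ G Ψ σ η z w₁ w)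
    (hG : IsStochasticGradient ρ G μ L a) {n : ℕ} {A : Set Ω}
    (hA : MeasurableSet[pastFiltration z h.measurable_sample n] A) :
    ∫ ω in A, ‖G a (z n ω)‖ ^ 2 ∂P = ∫ _ω in A, (∫ s, ‖G a s‖ ^ 2 ∂ρ) ∂P := by
  have hle := (pastFiltration z h.measurable_sample).le n
  have h1 : Measurable fun s => ‖G a s‖ ^ 2 := (hG.measurable_right a).norm.pow_const 2
  have h2 : StronglyMeasurable[MeasurableSpace.comap (z n) inferInstance]
      fun ω => ‖G a (z n ω)‖ ^ 2 :=
    (h1.comp (comap_measurable (z n))).stronglyMeasurable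
  have h3 := condExp_indep_eq (h.measurable_sample n).comap_le hle h2 (h.indep_past n).symm
  rw [← setIntegral_condExp hle (h.integrable_target_sq hG n) hA]
  refine setIntegral_congr_ae (hle A hA) ?_
  filter_upwards [h3] with ω hω _
  rw [hω, ← h.map_sample n, integral_map (h.measurable_sample n).aemeasurable
    h1.aestronglyMeasurable]

/-- By independence the law of (w_n, z_n) is a product, so Fubini reduces the claim to the bound at
each fixed `v`. -/
lemma le_integral_norm_gradient_oracle (h : IsMirrorDescent P ρ G Ψ σ η z w₁ w)
    (hG : IsStochasticGradient ρ G μ L a) {m : ℝ} (hm : ∀ v, m ≤ ∫ s, ‖G v s‖ ∂ρ) (n : ℕ) :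
    m ≤ ∫ ω, ‖G (w n ω) (z n ω)‖ ∂P := by
  have hw := h.measurable hG n
  have hz := h.measurable_sample n
  have h1 := (indepFun_iff_map_prod_eq_prod_map_map hw.aemeasurable hz.aemeasurable).1
    (h.indepFun_past (h.measurable_past hG n))
  have hpw : IsProbabilityMeasure (P.map (w n)) :=
    Measure.isProbabilityMeasure_map hw.aemeasurable
  have hρ : IsProbabilityMeasure ρ := by
    rw [← h.map_sample n]; exact Measure.isProbabilityMeasure_map hz.aemeasurable
  rw [h.map_sample n] at h1
  have hGm : AEStronglyMeasurable (fun q : W d × S => ‖G q.1 q.2‖)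
      (P.map fun ω => (w n ω, z n ω)) := hG.measurable.norm.aestronglyMeasurable
  have h2 : Integrable (fun q : W d × S => ‖G q.1 q.2‖) (P.map fun ω => (w n ω, z n ω)) :=
    (integrable_map_measure hGm (hw.prodMk hz).aemeasurable).2
      ((h.memLp_gradient_oracle hG n).integrable (by norm_num)).norm
  have h3 := integral_map (hw.prodMk hz).aemeasurable hGm
  rw [h1] at h2 h3
  rw [← h3, integral_prod _ h2]
  have h4 := integral_mono (integrable_const m) h2.integral_prod_left hm
  simpa using h4

lemma sq_le_integral_sq_gradient_oracle (h : IsMirrorDescent P ρ G Ψ σ η z w₁ w)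
    (hG : IsStochasticGradient ρ G μ L a) {m : ℝ} (hm0 : 0 ≤ m)
    (hm : ∀ v, m ≤ ∫ s, ‖G v s‖ ∂ρ) (n : ℕ) :
    m ^ 2 ≤ ∫ ω, ‖G (w n ω) (z n ω)‖ ^ 2 ∂P := by
  have h1 := h.le_integral_norm_gradient_oracle hG hm n
  have h2 : Integrable (fun ω => ‖G (w n ω) (z n ω)‖) P :=
    ((h.memLp_gradient_oracle hG n).integrable (by norm_num)).norm
  have h3 := integral_mono ((h2.const_mul (2 * m)).sub (integrable_const (m ^ 2)))
    (h.integrable_gradient_oracle_sq hG n) fun ω => by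
      -- The tangent of x ↦ x² at `m` replaces Jensen's inequality.
      change 2 * m * ‖G (w n ω) (z n ω)‖ - m ^ 2 ≤ ‖G (w n ω) (z n ω)‖ ^ 2
      nlinarith [sq_nonneg (‖G (w n ω) (z n ω)‖ - m)]
  simp only [Pi.sub_apply] at h3
  rw [integral_sub (h2.const_mul _) (integrable_const _), integral_const_mul] at h3
  simp only [integral_const, probReal_univ, one_smul] at h3
  nlinarith

end Integrability

end IsMirrorDescent

/-- `𝔼 D_Ψ(a, w_n)`. -/
def meanBregman {d : ℕ} {Ω : Type*} [MeasurableSpace Ω] (P : Measure Ω) (Ψ : W d → ℝ) (a : W d)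
    (w : ℕ → Ω → W d) (n : ℕ) : ℝ :=
  ∫ ω, bregman Ψ a (w n ω) ∂P

namespace IsMirrorDescent

variable {d : ℕ} {S Ω : Type*} [MeasurableSpace S] [mΩ : MeasurableSpace Ω]
  {P : Measure Ω} {ρ : Measure S} {G : W d → S → W d} {Ψ : W d → ℝ}
  {σ : ℝ} {η : ℕ → ℝ} {z : ℕ → Ω → S} {w₁ : W d} {w : ℕ → Ω → W d} {μ L : ℝ} {a : W d}

lemma _root_.OMD.meanSqError_nonneg (P : Measure Ω) (a : W d) (w : ℕ → Ω → W d) (n : ℕ) :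
    0 ≤ meanSqError P a w n :=
  integral_nonneg fun _ => sq_nonneg _

lemma meanBregman_nonneg (h : IsMirrorDescent P ρ G Ψ σ η z w₁ w) (n : ℕ) :
    0 ≤ meanBregman P Ψ a w n :=
  integral_nonneg fun _ => h.bregman_nonneg _ _

/-- By Fatou the lower limit has integral zero, hence vanishes almost everywhere; where a limit
exists it equals the lower limit. -/
lemma _root_.OMD.ae_tendsto_zero_of_integral {f : ℕ → Ω → ℝ} (hmeas : ∀ n, Measurable (f n))
    (hint : ∀ n, Integrable (f n) P) (hf : ∀ n ω, 0 ≤ f n ω) (hlim : Tendsto (fun n => ∫ ω, f n ω ∂P) atTop (𝓝 0))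
    (hconv : ∀ᵐ ω ∂P, ∃ c, Tendsto (fun n => f n ω) atTop (𝓝 c)) :
    ∀ᵐ ω ∂P, Tendsto (fun n => f n ω) atTop (𝓝 0) := by
  have h1 : ∫⁻ ω, liminf (fun n => ENNReal.ofReal (f n ω)) atTop ∂P ≤ 0 := by
    refine (lintegral_liminf_le' fun n => (hint n).aemeasurable.ennreal_ofReal).trans ?_
    have h2 : Tendsto (fun n => ∫⁻ ω, ENNReal.ofReal (f n ω) ∂P) atTop (𝓝 0) := by
      have h3 := ENNReal.tendsto_ofReal hlim
      rw [ENNReal.ofReal_zero] at h3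
      refine h3.congr fun n => ?_
      exact ofReal_integral_eq_lintegral_ofReal (hint n) (Eventually.of_forall (hf n))
    exact h2.liminf_eq.le
  have h2 : Measurable (fun ω => liminf (fun n => ENNReal.ofReal (f n ω)) atTop) :=
    Measurable.liminf fun n => (hmeas n).ennreal_ofReal
  have h3 := (lintegral_eq_zero_iff h2).1 (le_antisymm h1 zero_le)
  filter_upwards [h3, hconv] with ω hω ⟨c, hc⟩
  have h4 := (ENNReal.tendsto_ofReal hc).liminf_eq
  have hω' : liminf (fun n => ENNReal.ofReal (f n ω)) atTop = 0 := hω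
  rw [hω', eq_comm, ENNReal.ofReal_eq_zero] at h4
  have h5 : 0 ≤ c := ge_of_tendsto' hc fun n => hf n ω
  rwa [le_antisymm h4 h5] at hc

variable [IsProbabilityMeasure P]

lemma meanSqError_le (h : IsMirrorDescent P ρ G Ψ σ η z w₁ w)
    (hG : IsStochasticGradient ρ G μ L a) (n : ℕ) :
    meanSqError P a w n ≤ 2 / σ * meanBregman P Ψ a w n := by
  rw [meanBregman, ← integral_const_mul]
  exact integral_mono (h.integrable_sq hG n) ((h.integrable_bregman hG n).const_mul _)
    fun ω => h.norm_sq_le_bregman n ω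

lemma meanBregman_le_of_le (h : IsMirrorDescent P ρ G Ψ σ η z w₁ w)
    (hG : IsStochasticGradient ρ G μ L a) {δ C : ℝ}
    (hC : ∀ v, bregman Ψ a v ≤ δ + C * ‖a - v‖ ^ 2) (n : ℕ) :
    meanBregman P Ψ a w n ≤ δ + C * meanSqError P a w n := by
  have h2 := integral_mono (h.integrable_bregman hG n)
    ((integrable_const δ).add ((h.integrable_sq hG n).const_mul C)) fun ω => hC (w n ω)
  simp only [Pi.add_apply] at h2
  rw [integral_add (integrable_const δ) ((h.integrable_sq hG n).const_mul C),
    integral_const_mul] at h2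
  simp only [integral_const, probReal_univ, one_smul] at h2
  exact h2

lemma exists_meanBregman_le (h : IsMirrorDescent P ρ G Ψ σ η z w₁ w)
    (hG : IsStochasticGradient ρ G μ L a) {δ : ℝ} (hδ : 0 < δ) :
    ∃ C : ℝ, 0 < C ∧ ∀ n, meanBregman P Ψ a w n ≤ δ + C * meanSqError P a w n := by
  obtain ⟨C, hC, h1⟩ := h.exists_bregman_le a hδ
  exact ⟨C, hC, h.meanBregman_le_of_le hG h1⟩

lemma meanBregman_le_of_smooth (h : IsMirrorDescent P ρ G Ψ σ η z w₁ w)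
    (hG : IsStochasticGradient ρ G μ L a) {LΨ : ℝ} (hΨ : StronglySmoothWith Ψ LΨ) (n : ℕ) :
    meanBregman P Ψ a w n ≤ LΨ / 2 * meanSqError P a w n := by
  simpa using h.meanBregman_le_of_le hG (δ := 0) (fun v => by simpa using hΨ.2 a v) n

lemma tendsto_meanSqError (h : IsMirrorDescent P ρ G Ψ σ η z w₁ w)
    (hG : IsStochasticGradient ρ G μ L a)
    (hx : Tendsto (meanBregman P Ψ a w) atTop (𝓝 0)) :
    Tendsto (meanSqError P a w) atTop (𝓝 0) := by
  refine squeeze_zero (meanSqError_nonneg P a w) (h.meanSqError_le hG) ?_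
  simpa using hx.const_mul (2 / σ)

lemma tendsto_meanBregman (h : IsMirrorDescent P ρ G Ψ σ η z w₁ w)
    (hG : IsStochasticGradient ρ G μ L a)
    (he : Tendsto (meanSqError P a w) atTop (𝓝 0)) :
    Tendsto (meanBregman P Ψ a w) atTop (𝓝 0) := by
  rw [Metric.tendsto_nhds]
  intro ε hε
  obtain ⟨C, hC, h1⟩ := h.exists_meanBregman_le hG (half_pos hε)
  filter_upwards [he.eventually (gt_mem_nhds (show 0 < ε / 2 / C by positivity))] with n hn
  rw [Real.dist_eq, sub_zero, abs_of_nonneg (h.meanBregman_nonneg n)]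
  rw [lt_div_iff₀ hC] at hn
  linarith [h1 n]

/-! ### Recursions for the mean Bregman distance -/

section Recursion

lemma setIntegral_bregman_succ_le (h : IsMirrorDescent P ρ G Ψ σ η z w₁ w)
    (hG : IsStochasticGradient ρ G μ L a) {n : ℕ} {A : Set Ω}
    (hA : MeasurableSet[pastFiltration z h.measurable_sample n] A) :
    ∫ ω in A, bregman Ψ a (w (n + 1) ω) ∂P ≤ ∫ ω in A, bregman Ψ a (w n ω) ∂P
      - (η n * μ - η n ^ 2 * L ^ 2 / σ) * ∫ ω in A, ‖a - w n ω‖ ^ 2 ∂P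
      + η n ^ 2 / σ * ∫ _ω in A, (∫ s, ‖G a s‖ ^ 2 ∂ρ) ∂P := by
  have i1 := (h.integrable_bregman hG n).restrict (s := A)
  have i2 := ((h.integrable_sq hG n).restrict (s := A)).const_mul
    (η n * μ - η n ^ 2 * L ^ 2 / σ)
  have i3 := ((h.integrable_inner_target hG n).restrict (s := A)).const_mul (η n)
  have i4 := ((h.integrable_target_sq hG n).restrict (s := A)).const_mul (η n ^ 2 / σ)
  have h1 := integral_mono (h.integrable_bregman hG (n + 1)).restrict
    (((i1.sub i2).sub i3).add i4) fun ω => h.bregman_succ_le hG n ω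
  rw [integral_add' ((i1.sub i2).sub i3) i4, integral_sub' (i1.sub i2) i3, integral_sub' i1 i2,
    integral_const_mul, integral_const_mul, integral_const_mul, h.setIntegral_inner_target hG hA,
    h.setIntegral_target_sq hG hA, mul_zero, sub_zero] at h1
  exact h1

lemma meanBregman_succ_le (h : IsMirrorDescent P ρ G Ψ σ η z w₁ w)
    (hG : IsStochasticGradient ρ G μ L a) (n : ℕ) :
    meanBregman P Ψ a w (n + 1) ≤ meanBregman P Ψ a w n
      - (η n * μ - η n ^ 2 * L ^ 2 / σ) * meanSqError P a w n
      + η n ^ 2 / σ * ∫ s, ‖G a s‖ ^ 2 ∂ρ := by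
  simpa [meanBregman, meanSqError] using h.setIntegral_bregman_succ_le hG (n := n)
    MeasurableSet.univ

lemma ae_target_eq_zero (h : IsMirrorDescent P ρ G Ψ σ η z w₁ w)
    (hG : IsStochasticGradient ρ G μ L a) (h0 : ∫ s, ‖G a s‖ ∂ρ = 0) (n : ℕ) :
    ∀ᵐ ω ∂P, G a (z n ω) = 0 := by
  have hz := (h.measurable_sample n).aemeasurable (μ := P)
  rw [← h.map_sample n, integral_map hz
    (hG.measurable_right a).norm.aestronglyMeasurable, integral_eq_zero_iff_of_nonneg
    (fun _ => norm_nonneg _) ((h.memLp_target hG n).integrable (by norm_num)).norm] at h0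
  filter_upwards [h0] with ω hω
  exact norm_eq_zero.1 hω

lemma meanBregman_succ_le_of_zero (h : IsMirrorDescent P ρ G Ψ σ η z w₁ w)
    (hG : IsStochasticGradient ρ G μ L a) (h0 : ∫ s, ‖G a s‖ ∂ρ = 0) {n : ℕ}
    (hη : η n * L ≤ σ) :
    meanBregman P Ψ a w (n + 1) ≤ meanBregman P Ψ a w n
      - μ / 2 * η n * meanSqError P a w n := by
  have i1 := h.integrable_bregman hG n
  have i2 := (h.integrable_sq hG n).const_mul (μ / 2 * η n)
  have h1 := integral_mono_ae (h.integrable_bregman hG (n + 1)) (i1.sub i2) (by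
    filter_upwards [h.ae_target_eq_zero hG h0 n] with ω hω
    exact h.bregman_succ_le_of_eq_zero hG hω hη)
  rw [integral_sub' i1 i2, integral_const_mul] at h1
  exact h1

lemma le_meanBregman_succ_add (h : IsMirrorDescent P ρ G Ψ σ η z w₁ w)
    (hG : IsStochasticGradient ρ G μ L a) (n : ℕ) :
    (1 - 2 * L / σ * η n) * meanBregman P Ψ a w n
      + ∫ ω, bregman Ψ (w n ω) (w (n + 1) ω) ∂P ≤ meanBregman P Ψ a w (n + 1) := by
  have i1 := h.integrable_bregman hG n
  have i2 := (h.integrable_sq hG n).const_mul (η n * L)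
  have i3 := (h.integrable_inner_target hG n).const_mul (η n)
  have i4 := h.integrable_bregman_step hG n
  have h1 := integral_mono (((i1.sub i2).sub i3).add i4) (h.integrable_bregman hG (n + 1))
    fun ω => h.le_bregman_succ hG n ω
  rw [integral_add' ((i1.sub i2).sub i3) i4, integral_sub' (i1.sub i2) i3, integral_sub' i1 i2,
    integral_const_mul, integral_const_mul, h.integral_inner_target hG, mul_zero, sub_zero] at h1
  have h2 := mul_le_mul_of_nonneg_left (h.meanSqError_le hG n)
    (mul_pos (h.eta_pos n) hG.L_pos).le
  have h3 : η n * L * (2 / σ * meanBregman P Ψ a w n) =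
      2 * L / σ * η n * meanBregman P Ψ a w n := by ring
  rw [h3] at h2
  change meanBregman P Ψ a w n - η n * L * meanSqError P a w n + _ ≤ meanBregman P Ψ a w (n + 1)
    at h1
  linarith

lemma le_meanBregman_succ (h : IsMirrorDescent P ρ G Ψ σ η z w₁ w)
    (hG : IsStochasticGradient ρ G μ L a) (n : ℕ) :
    (1 - 2 * L / σ * η n) * meanBregman P Ψ a w n ≤ meanBregman P Ψ a w (n + 1) := by
  have h1 : 0 ≤ ∫ ω, bregman Ψ (w n ω) (w (n + 1) ω) ∂P :=
    integral_nonneg fun _ => h.bregman_nonneg _ _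
  linarith [h.le_meanBregman_succ_add hG n]

lemma le_meanBregman_succ_of_smooth (h : IsMirrorDescent P ρ G Ψ σ η z w₁ w)
    (hG : IsStochasticGradient ρ G μ L a) {m LΨ : ℝ} (hm0 : 0 ≤ m)
    (hm : ∀ v, m ≤ ∫ s, ‖G v s‖ ∂ρ) (hL : 0 < LΨ) (hΨ : StronglySmoothWith Ψ LΨ) (n : ℕ) :
    (1 - 2 * L / σ * η n) * meanBregman P Ψ a w n + m ^ 2 / (2 * LΨ) * η n ^ 2
      ≤ meanBregman P Ψ a w (n + 1) := by
  have h1 := integral_mono ((h.integrable_gradient_oracle_sq hG n).const_mul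
    (η n ^ 2 / (2 * LΨ))) (h.integrable_bregman_step hG n) fun ω => h.le_bregman_step hL hΨ n ω
  rw [integral_const_mul] at h1
  have h2 := mul_le_mul_of_nonneg_left (h.sq_le_integral_sq_gradient_oracle hG hm0 hm n)
    (by positivity : 0 ≤ η n ^ 2 / (2 * LΨ))
  have h3 : m ^ 2 / (2 * LΨ) * η n ^ 2 = η n ^ 2 / (2 * LΨ) * m ^ 2 := by ring
  linarith [h.le_meanBregman_succ_add hG n]

/-- The product of step size and gradient norm is the displacement of ∇Ψ, bounded by the deviations
of ∇Ψ(w_n) and ∇Ψ(w_{n+1}) from ∇Ψ(a). No smoothness of Ψ enters. -/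
lemma exists_eta_mul_le (h : IsMirrorDescent P ρ G Ψ σ η z w₁ w)
    (hG : IsStochasticGradient ρ G μ L a) {m : ℝ} (hm : ∀ v, m ≤ ∫ s, ‖G v s‖ ∂ρ) {δ : ℝ}
    (hδ : 0 < δ) :
    ∃ C : ℝ, 0 < C ∧ ∀ n,
      η n * m ≤ δ + C * (meanSqError P a w n + meanSqError P a w (n + 1)) := by
  obtain ⟨C, hC, h1⟩ := h.quadraticallyBounded.exists_norm_gradient_sub_le h.stronglyConvex.1
    h.bregman_nonneg a (half_pos hδ)
  refine ⟨C, hC, fun n => ?_⟩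
  have i1 := (h.integrable_sq hG n).add (h.integrable_sq hG (n + 1))
  have i2 : Integrable (fun ω => ‖G (w n ω) (z n ω)‖) P :=
    ((h.memLp_gradient_oracle hG n).integrable (by norm_num)).norm
  have h2 := integral_mono (i2.const_mul (η n)) ((integrable_const δ).add (i1.const_mul C))
    fun ω => by
      have h3 : η n * ‖G (w n ω) (z n ω)‖ = ‖gradient Ψ (w n ω) - gradient Ψ (w (n + 1) ω)‖ := by
        rw [h.gradient_sub, norm_smul, Real.norm_of_nonneg (h.eta_pos n).le]
      have h4 := norm_sub_le (gradient Ψ (w n ω) - gradient Ψ a)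
        (gradient Ψ (w (n + 1) ω) - gradient Ψ a)
      rw [sub_sub_sub_cancel_right] at h4
      change η n * ‖G (w n ω) (z n ω)‖ ≤ δ + C * (‖a - w n ω‖ ^ 2 + ‖a - w (n + 1) ω‖ ^ 2)
      linarith [h1 (w n ω), h1 (w (n + 1) ω)]
  rw [integral_const_mul, integral_add' (integrable_const δ) (i1.const_mul C),
    integral_const_mul, integral_add' (h.integrable_sq hG n) (h.integrable_sq hG (n + 1))] at h2
  have h3 := mul_le_mul_of_nonneg_left (h.le_integral_norm_gradient_oracle hG hm n)
    (h.eta_pos n).le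
  simp only [integral_const, probReal_univ, one_smul] at h2
  exact h3.trans h2

end Recursion

/-! ### Part (a): positive variances -/

section PositiveVariance

lemma tendsto_meanBregman_of_tendsto_eta (h : IsMirrorDescent P ρ G Ψ σ η z w₁ w)
    (hG : IsStochasticGradient ρ G μ L a) (hη : Tendsto η atTop (𝓝 0)) (hdiv : ¬ Summable η) :
    Tendsto (meanBregman P Ψ a w) atTop (𝓝 0) := by
  set V := ∫ s, ‖G a s‖ ^ 2 ∂ρ with hV
  have hσ := h.sigma_pos
  have hμ := hG.mu_pos
  have hL := hG.L_pos
  have hr : Tendsto (fun n => V / σ * η n) atTop (𝓝 0) := by simpa using hη.const_mul (V / σ)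
  have hrη : Tendsto (fun n => V / σ * η n * η n) atTop (𝓝 0) := by simpa using hr.mul hη
  refine tendsto_zero_of_recursion (half_pos hμ) h.meanBregman_nonneg
    (meanSqError_nonneg P a w) (fun n => (h.eta_pos n).le) hdiv hr hrη
    (fun δ hδ => h.exists_meanBregman_le hG hδ) ?_
  filter_upwards [hη.eventually (gt_mem_nhds (show 0 < μ / 2 * σ / L ^ 2 by positivity))] with n hn
  refine (h.meanBregman_succ_le hG n).trans ?_
  have hη0 := h.eta_pos n
  have h1 : η n * L ^ 2 ≤ μ / 2 * σ := by
    rw [lt_div_iff₀ (by positivity)] at hn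
    exact hn.le
  have h2 : η n ^ 2 * L ^ 2 / σ ≤ μ / 2 * η n := by
    rw [div_le_iff₀ hσ]
    nlinarith
  have h3 := mul_le_mul_of_nonneg_right h2 (meanSqError_nonneg P a w n)
  have h4 : η n ^ 2 / σ * V = V / σ * η n * η n := by ring
  rw [h4]
  linarith

lemma tendsto_eta_of_tendsto_meanSqError (h : IsMirrorDescent P ρ G Ψ σ η z w₁ w)
    (hG : IsStochasticGradient ρ G μ L a) {m : ℝ} (hm0 : 0 < m)
    (hm : ∀ v, m ≤ ∫ s, ‖G v s‖ ∂ρ) (he : Tendsto (meanSqError P a w) atTop (𝓝 0)) :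
    Tendsto η atTop (𝓝 0) := by
  rw [Metric.tendsto_nhds]
  intro ε hε
  obtain ⟨C, hC, h1⟩ := h.exists_eta_mul_le hG hm (show 0 < ε * m / 2 by positivity)
  have h2 : Tendsto (fun n => C * (meanSqError P a w n + meanSqError P a w (n + 1))) atTop
      (𝓝 0) := by
    simpa using (he.add ((tendsto_add_atTop_iff_nat 1).2 he)).const_mul C
  filter_upwards [h2.eventually (gt_mem_nhds (show 0 < ε * m / 2 by positivity))] with n hn
  rw [Real.dist_eq, sub_zero, abs_of_pos (h.eta_pos n)]
  have h3 : η n * m < ε * m := by linarith [h1 n]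
  exact lt_of_mul_lt_mul_right h3 hm0.le

/-- The lower recursions need a positive starting value. Two consecutive zero errors are impossible,
since each step moves ∇Ψ by at least `η n * m` on average. -/
lemma exists_meanBregman_pos (h : IsMirrorDescent P ρ G Ψ σ η z w₁ w)
    (hG : IsStochasticGradient ρ G μ L a) {m : ℝ} (hm0 : 0 < m)
    (hm : ∀ v, m ≤ ∫ s, ‖G v s‖ ∂ρ) (N : ℕ) :
    ∃ n, N ≤ n ∧ 0 < meanBregman P Ψ a w n := by
  by_contra hcon
  push Not at hcon
  have h0 : ∀ n, N ≤ n → meanSqError P a w n ≤ 0 := fun n hn =>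
    (h.meanSqError_le hG n).trans
      (mul_nonpos_of_nonneg_of_nonpos (div_pos two_pos h.sigma_pos).le (hcon n hn))
  have hpos : 0 < η N * m := mul_pos (h.eta_pos N) hm0
  obtain ⟨C, hC, h1⟩ := h.exists_eta_mul_le hG hm (half_pos hpos)
  have h2 := h1 N
  have h3 := h0 N le_rfl
  have h4 := h0 (N + 1) (Nat.le_succ N)
  nlinarith

lemma not_summable_of_tendsto_meanSqError (h : IsMirrorDescent P ρ G Ψ σ η z w₁ w)
    (hG : IsStochasticGradient ρ G μ L a) {m : ℝ} (hm0 : 0 < m)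
    (hm : ∀ v, m ≤ ∫ s, ‖G v s‖ ∂ρ) (he : Tendsto (meanSqError P a w) atTop (𝓝 0)) :
    ¬ Summable η := by
  intro hs
  have hLσ : 0 < 2 * L / σ := div_pos (by linarith [hG.L_pos]) h.sigma_pos
  have h1 : Tendsto (fun n => 2 * L / σ * η n) atTop (𝓝 0) := by
    simpa using hs.tendsto_atTop_zero.const_mul (2 * L / σ)
  obtain ⟨N₀, hN₀⟩ := eventually_atTop.1
    (h1.eventually (gt_mem_nhds (show (0 : ℝ) < 1 / 2 by norm_num)))
  obtain ⟨N, hN, hpos⟩ := h.exists_meanBregman_pos hG hm0 hm N₀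
  obtain ⟨c, hc, hle⟩ := exists_pos_le_of_summable hLσ.le (fun n => (h.eta_pos n).le) hs
    (show (1 / 2 : ℝ) < 1 by norm_num) (fun n hn => (hN₀ n (hN.trans hn)).le) hpos
    fun n _ => h.le_meanBregman_succ hG n
  obtain ⟨n, hn, hn'⟩ := (((h.tendsto_meanBregman hG he).eventually (gt_mem_nhds hc)).and
    (eventually_ge_atTop N)).exists
  linarith [hle n hn']

lemma exists_div_le_meanSqError (h : IsMirrorDescent P ρ G Ψ σ η z w₁ w)
    (hG : IsStochasticGradient ρ G μ L a) {m LΨ : ℝ} (hm0 : 0 < m)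
    (hm : ∀ v, m ≤ ∫ s, ‖G v s‖ ∂ρ) (hL : 0 < LΨ) (hΨ : StronglySmoothWith Ψ LΨ)
    (hη : Tendsto η atTop (𝓝 0)) :
    ∃ N : ℕ, 1 ≤ N ∧ ∃ C : ℝ, 0 < C ∧ ∀ n : ℕ, N ≤ n → C / n ≤ meanSqError P a w n := by
  have hLσ : 0 < 2 * L / σ := div_pos (by linarith [hG.L_pos]) h.sigma_pos
  have h1 : Tendsto (fun n => 2 * L / σ * η n) atTop (𝓝 0) := by
    simpa using hη.const_mul (2 * L / σ)
  obtain ⟨N₀, hN₀⟩ := eventually_atTop.1 (h1.eventually (gt_mem_nhds one_pos))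
  obtain ⟨N, hN, hpos⟩ := h.exists_meanBregman_pos hG hm0 hm (max N₀ 1)
  have hN1 : 1 ≤ N := (le_max_right _ _).trans hN
  obtain ⟨C, hC, hle⟩ := exists_div_le_of_recursion hLσ
    (show 0 < m ^ 2 / (2 * LΨ) by positivity) hN1
    (fun n hn => (hN₀ n (((le_max_left _ _).trans hN).trans hn)).le) hpos
    fun n _ => h.le_meanBregman_succ_of_smooth hG hm0.le hm hL hΨ n
  refine ⟨N, hN1, 2 / LΨ * C, by positivity, fun n hn => ?_⟩
  have h2 := (hle n hn).trans (h.meanBregman_le_of_smooth hG hΨ n)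
  calc 2 / LΨ * C / n = 2 / LΨ * (C / n) := by ring
    _ ≤ 2 / LΨ * (LΨ / 2 * meanSqError P a w n) := by gcongr
    _ = _ := by field_simp

/-- Half of the drift absorbs the L²η² term; with smooth Ψ the other half contracts by 1 - μη/LΨ,
and the step size makes this exactly 1 - 2/(n+2). -/
lemma exists_meanSqError_le_div (h : IsMirrorDescent P ρ G Ψ σ η z w₁ w)
    (hG : IsStochasticGradient ρ G μ L a) {LΨ : ℝ} (hL : 0 < LΨ) (hΨ : StronglySmoothWith Ψ LΨ)
    (hη : ∀ n : ℕ, η n = 2 * LΨ / μ / ((n : ℝ) + 2)) :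
    ∃ K : ℝ, ∃ N : ℕ, ∀ n : ℕ, N ≤ n → meanSqError P a w n ≤ K / (n + 1) := by
  set V := ∫ s, ‖G a s‖ ^ 2 ∂ρ with hV
  have hσ := h.sigma_pos
  have hμ := hG.mu_pos
  have hL' := hG.L_pos
  have hη0 : Tendsto η atTop (𝓝 0) := by
    have h1 : Tendsto (fun n : ℕ => ((n : ℝ) + 2)) atTop atTop :=
      tendsto_atTop_add_const_right _ _ tendsto_natCast_atTop_atTop
    rw [show η = fun n : ℕ => 2 * LΨ / μ / ((n : ℝ) + 2) from funext hη]
    exact h1.const_div_atTop _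
  obtain ⟨N, hN⟩ := eventually_atTop.1
    (hη0.eventually (gt_mem_nhds (show 0 < μ / 2 * σ / L ^ 2 by positivity)))
  obtain ⟨K, hK⟩ := exists_le_div_of_recursion (y := meanBregman P Ψ a w)
    (C := (2 * LΨ / μ) ^ 2 / σ * V) (N := N) fun n hn => by
      refine (h.meanBregman_succ_le hG n).trans ?_
      have hηn := h.eta_pos n
      have h1 : η n * L ^ 2 ≤ μ / 2 * σ := by
        have := hN n hn
        rw [lt_div_iff₀ (by positivity)] at this
        exact this.le
      have h2 : η n ^ 2 * L ^ 2 / σ ≤ μ / 2 * η n := by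
        rw [div_le_iff₀ hσ]
        nlinarith
      have h3 := mul_le_mul_of_nonneg_right h2 (meanSqError_nonneg P a w n)
      have h4 := mul_le_mul_of_nonneg_left (h.meanBregman_le_of_smooth hG hΨ n)
        (show 0 ≤ μ * η n / LΨ by positivity)
      have h5 : μ * η n / LΨ * (LΨ / 2 * meanSqError P a w n) =
          μ / 2 * η n * meanSqError P a w n := by field_simp
      have h6 : μ * η n / LΨ = 2 / ((n : ℝ) + 2) := by
        rw [hη n]
        field_simp
      have h7 : η n ^ 2 / σ * V = (2 * LΨ / μ) ^ 2 / σ * V / ((n : ℝ) + 2) ^ 2 := by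
        rw [hη n, div_pow]
        ring
      rw [h5, h6] at h4
      rw [h7]
      linarith
  refine ⟨2 / σ * K, N, fun n hn => (h.meanSqError_le hG n).trans ?_⟩
  rw [mul_div_assoc]
  gcongr
  exact hK n hn

end PositiveVariance

/-! ### Part (b): zero variances -/

section ZeroVariance

lemma meanBregman_zero (h : IsMirrorDescent P ρ G Ψ σ η z w₁ w) (a : W d) :
    meanBregman P Ψ a w 0 = bregman Ψ a w₁ := by
  simp [meanBregman, h.init]

lemma meanSqError_zero (h : IsMirrorDescent P ρ G Ψ σ η z w₁ w) (a : W d) :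
    meanSqError P a w 0 = ‖a - w₁‖ ^ 2 := by
  simp [meanSqError, h.init]

lemma tendsto_meanSqError_iff_of_zero (h : IsMirrorDescent P ρ G Ψ σ η z w₁ w)
    (hG : IsStochasticGradient ρ G μ L a) (hne : w₁ ≠ a) (h0 : ∫ s, ‖G a s‖ ∂ρ = 0) {κ : ℝ}
    (hκ : 0 < κ) (hη : ∀ n, η n ≤ σ / ((2 + κ) * L)) :
    Tendsto (meanSqError P a w) atTop (𝓝 0) ↔ ¬ Summable η := by
  have hσ := h.sigma_pos
  have hμ := hG.mu_pos
  have hL := hG.L_pos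
  have hη' : ∀ n, η n * L ≤ σ / (2 + κ) := fun n => by
    have h1 := mul_le_mul_of_nonneg_right (hη n) hL.le
    have h2 : σ / ((2 + κ) * L) * L = σ / (2 + κ) := by field_simp
    rwa [h2] at h1
  constructor
  · intro he hs
    have hpos : 0 < meanBregman P Ψ a w 0 := by
      rw [h.meanBregman_zero]
      refine lt_of_lt_of_le ?_ (h.stronglyConvex.2 a w₁)
      have : 0 < ‖a - w₁‖ := norm_pos_iff.2 (sub_ne_zero.2 hne.symm)
      positivity
    -- The margin κ keeps every factor at least 1 - 2/(2+κ) > 0, so the initial distance, positive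
    -- since w₁ ≠ a, never dies out.
    obtain ⟨c, hc, hle⟩ := exists_pos_le_of_summable (a := 2 * L / σ) (q := 2 / (2 + κ))
      (by positivity) (fun n => (h.eta_pos n).le) hs
      (by rw [div_lt_one (by positivity)]; linarith)
      (fun n _ => by
        calc 2 * L / σ * η n = 2 / σ * (η n * L) := by ring
          _ ≤ 2 / σ * (σ / (2 + κ)) := by gcongr; exact hη' n
          _ = 2 / (2 + κ) := by field_simp) hpos
      fun n _ => h.le_meanBregman_succ hG n
    obtain ⟨n, hn⟩ := ((h.tendsto_meanBregman hG he).eventually (gt_mem_nhds hc)).exists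
    linarith [hle n (Nat.zero_le n)]
  · intro hdiv
    refine h.tendsto_meanSqError hG (tendsto_zero_of_recursion (r := fun _ => 0) (half_pos hμ)
      h.meanBregman_nonneg (meanSqError_nonneg P a w) (fun n => (h.eta_pos n).le) hdiv
      tendsto_const_nhds (by simp) (fun δ hδ => h.exists_meanBregman_le hG hδ)
      (Eventually.of_forall fun n => ?_))
    rw [zero_mul, add_zero]
    refine h.meanBregman_succ_le_of_zero hG h0 ((hη' n).trans ?_)
    rw [div_le_iff₀ (by positivity)]
    nlinarith

lemma exists_linear_rate (h : IsMirrorDescent P ρ G Ψ σ η z w₁ w)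
    (hG : IsStochasticGradient ρ G μ L a) (hne : w₁ ≠ a) (h0 : ∫ s, ‖G a s‖ ∂ρ = 0) {LΨ : ℝ}
    (hΨL : 0 < LΨ) (hΨ : StronglySmoothWith Ψ LΨ) (hconst : ∀ n, η n = η 0)
    (hη : η 0 < σ / (2 * L)) :
    ∃ c₁ c₂ : ℝ, 0 < c₁ ∧ c₁ < 1 ∧ 0 < c₂ ∧ c₂ < 1 ∧ ∀ T : ℕ,
      c₁ ^ T * ‖a - w₁‖ ^ 2 ≤ meanSqError P a w T ∧
      meanSqError P a w T ≤ LΨ / σ * c₂ ^ T * ‖a - w₁‖ ^ 2 := by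
  have hσ := h.sigma_pos
  have hμ := hG.mu_pos
  have hL := hG.L_pos
  have hη0 := h.eta_pos 0
  have hσL : σ ≤ LΨ := h.stronglyConvex.sigma_le hΨ hne
  rw [lt_div_iff₀ (by positivity)] at hη
  set q := 1 - 2 * L / σ * η 0 with hq
  have hq0 : 0 < q := by
    have : 2 * L / σ * η 0 < 1 := by
      rw [div_mul_eq_mul_div, div_lt_one hσ]
      linarith
    linarith
  have hq1 : q < 1 := by
    have : 0 < 2 * L / σ * η 0 := by positivity
    linarith
  have hr0 : 0 < σ / LΨ := by positivity
  have hr1 : σ / LΨ ≤ 1 := (div_le_one hΨL).2 hσL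
  -- The maximum with 1/2 secures positivity without comparing μ and L.
  set c₂ := max (1 - μ * η 0 / LΨ) (1 / 2) with hc₂
  have hc₂0 : 0 < c₂ := lt_of_lt_of_le (by norm_num) (le_max_right _ _)
  have hc₂1 : c₂ < 1 := max_lt (by
    have : 0 < μ * η 0 / LΨ := by positivity
    linarith) (by norm_num)
  -- The lower bound allows no prefactor, so the condition ratio σ/LΨ ≤ 1 is hidden in the base: its
  -- T-th power is at most σ/LΨ once T ≥ 1, and T = 0 is an equality.
  refine ⟨q * (σ / LΨ), c₂, by positivity, by nlinarith, hc₂0, hc₂1, fun T => ⟨?_, ?_⟩⟩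
  · rcases Nat.eq_zero_or_pos T with rfl | hT
    · rw [h.meanSqError_zero, pow_zero, one_mul]
    · have h1 : ∀ n, q ^ n * meanBregman P Ψ a w 0 ≤ meanBregman P Ψ a w n := by
        intro n
        induction n with
        | zero => simp
        | succ n ih =>
          have h2 := h.le_meanBregman_succ hG n
          rw [hconst n, ← hq] at h2
          refine le_trans ?_ h2
          rw [pow_succ', mul_assoc]
          gcongr
      have h2 := h.stronglyConvex.2 a w₁
      rw [← h.meanBregman_zero a (P := P)] at h2
      have h3 := h.meanBregman_le_of_smooth hG hΨ T
      have h4 : q ^ T * (σ / 2 * ‖a - w₁‖ ^ 2) ≤ LΨ / 2 * meanSqError P a w T :=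
        (mul_le_mul_of_nonneg_left h2 (by positivity)).trans ((h1 T).trans h3)
      have h5 : (σ / LΨ) ^ T ≤ σ / LΨ := by
        simpa using pow_le_pow_of_le_one hr0.le hr1 hT
      calc (q * (σ / LΨ)) ^ T * ‖a - w₁‖ ^ 2 = q ^ T * (σ / LΨ) ^ T * ‖a - w₁‖ ^ 2 := by
            rw [mul_pow]
        _ ≤ q ^ T * (σ / LΨ) * ‖a - w₁‖ ^ 2 := by gcongr
        _ = 2 / LΨ * (q ^ T * (σ / 2 * ‖a - w₁‖ ^ 2)) := by ring
        _ ≤ 2 / LΨ * (LΨ / 2 * meanSqError P a w T) := by gcongr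
        _ = _ := by field_simp
  · have h1 : ∀ n, meanBregman P Ψ a w n ≤ c₂ ^ n * meanBregman P Ψ a w 0 := by
      intro n
      induction n with
      | zero => simp
      | succ n ih =>
        have h2 := h.meanBregman_succ_le_of_zero hG h0 (n := n) (by rw [hconst n]; nlinarith)
        rw [hconst n] at h2
        have h4 := mul_le_mul_of_nonneg_left (h.meanBregman_le_of_smooth hG hΨ n)
          (show 0 ≤ μ * η 0 / LΨ by positivity)
        have h5 : μ * η 0 / LΨ * (LΨ / 2 * meanSqError P a w n) =
          μ / 2 * η 0 * meanSqError P a w n := by field_simp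
        rw [h5] at h4
        have h6 : (1 - μ * η 0 / LΨ) * meanBregman P Ψ a w n ≤ c₂ * meanBregman P Ψ a w n :=
          mul_le_mul_of_nonneg_right (le_max_left _ _) (h.meanBregman_nonneg n)
        rw [pow_succ', mul_assoc]
        have h7 := mul_le_mul_of_nonneg_left ih hc₂0.le
        linarith
    have h2 := hΨ.2 a w₁
    rw [← h.meanBregman_zero a (P := P)] at h2
    calc meanSqError P a w T ≤ 2 / σ * meanBregman P Ψ a w T := h.meanSqError_le hG T
      _ ≤ 2 / σ * (c₂ ^ T * (LΨ / 2 * ‖a - w₁‖ ^ 2)) := by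
        gcongr
        exact (h1 T).trans (by gcongr)
      _ = _ := by ring

end ZeroVariance

/-! ### Part (c): almost sure convergence -/

section AlmostSure

/-- `L¹`-bounded supermartingales converge almost surely. -/
lemma _root_.MeasureTheory.Supermartingale.exists_ae_tendsto {ℱ : Filtration ℕ mΩ}
    {f : ℕ → Ω → ℝ} (hf : Supermartingale f ℱ P) {R : ℝ} (hR : ∀ n, ∫ ω, ‖f n ω‖ ∂P ≤ R) :
    ∀ᵐ ω ∂P, ∃ c, Tendsto (fun n => f n ω) atTop (𝓝 c) := by
  have h1 := hf.neg.exists_ae_tendsto_of_bdd (R := R.toNNReal) fun n => by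
    have h2 : eLpNorm ((-f) n) 1 P = ENNReal.ofReal (∫ ω, ‖f n ω‖ ∂P) := by
      rw [Pi.neg_apply, eLpNorm_neg, eLpNorm_one_eq_lintegral_enorm,
        ofReal_integral_norm_eq_lintegral_enorm (hf.integrable n)]
    rw [h2]
    exact ENNReal.ofReal_le_ofReal (hR n)
  filter_upwards [h1] with ω ⟨c, hc⟩
  exact ⟨-c, by simpa using hc.neg⟩

/-- Subtracting the noise budget (V/σ) ∑ η² gives an L¹-bounded supermartingale, and the budget
itself converges. Time is shifted by `N` because the drift is known to be nonnegative only for small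
steps. -/
lemma exists_ae_tendsto_bregman (h : IsMirrorDescent P ρ G Ψ σ η z w₁ w)
    (hG : IsStochasticGradient ρ G μ L a) (hs : Summable fun n => η n ^ 2)
    (hbdd : ∃ B, ∀ n, meanBregman P Ψ a w n ≤ B) {N : ℕ}
    (hN : ∀ n, N ≤ n → η n * L ^ 2 / σ ≤ μ) :
    ∀ᵐ ω ∂P, ∃ c, Tendsto (fun n => bregman Ψ a (w n ω)) atTop (𝓝 c) := by
  set V := ∫ s, ‖G a s‖ ^ 2 ∂ρ with hV
  have hV0 : 0 ≤ V := integral_nonneg fun _ => sq_nonneg _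
  have hσ := h.sigma_pos
  obtain ⟨B, hB⟩ := hbdd
  set ℱ := pastFiltration z h.measurable_sample with hℱ
  let 𝒢 : Filtration ℕ mΩ :=
    ⟨fun k => ℱ (k + N), fun i j hij => ℱ.mono (Nat.add_le_add_right hij N), fun k => ℱ.le _⟩
  let r : ℕ → ℝ := fun k => V / σ * ∑ i ∈ Finset.range k, η (i + N) ^ 2
  have hs' : Summable fun i => η (i + N) ^ 2 :=
    (summable_nat_add_iff (f := fun n => η n ^ 2) N).2 hs
  have hr : Tendsto r atTop (𝓝 (V / σ * ∑' i, η (i + N) ^ 2)) :=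
    hs'.hasSum.tendsto_sum_nat.const_mul _
  have hr0 : ∀ k, 0 ≤ r k := fun k =>
    mul_nonneg (by positivity) (Finset.sum_nonneg fun _ _ => sq_nonneg _)
  have hrle : ∀ k, r k ≤ V / σ * ∑' i, η (i + N) ^ 2 := fun k =>
    mul_le_mul_of_nonneg_left (hs'.sum_le_tsum _ fun _ _ => sq_nonneg _) (by positivity)
  let f : ℕ → Ω → ℝ := fun k ω => bregman Ψ a (w (k + N) ω) - r k
  have hfint : ∀ k, Integrable (f k) P := fun k =>
    (h.integrable_bregman hG (k + N)).sub (integrable_const _)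
  have hsuper : Supermartingale f 𝒢 P := by
    refine supermartingale_of_setIntegral_succ_le
      (fun k => (h.stronglyMeasurable_bregman hG (k + N)).sub stronglyMeasurable_const) hfint ?_
    intro k A hA
    have h1 := h.setIntegral_bregman_succ_le hG (n := k + N) hA
    have hk : k + 1 + N = k + N + 1 := by omega
    have h2 : 0 ≤ (η (k + N) * μ - η (k + N) ^ 2 * L ^ 2 / σ) *
        ∫ ω in A, ‖a - w (k + N) ω‖ ^ 2 ∂P := by
      refine mul_nonneg ?_ (integral_nonneg fun _ => sq_nonneg _)
      have h3 := mul_le_mul_of_nonneg_left (hN (k + N) (by omega)) (h.eta_pos (k + N)).le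
      have h4 : η (k + N) ^ 2 * L ^ 2 / σ = η (k + N) * (η (k + N) * L ^ 2 / σ) := by ring
      rw [h4]
      linarith
    have h3 : r (k + 1) = r k + η (k + N) ^ 2 / σ * V := by
      simp only [r, Finset.sum_range_succ]
      ring
    change ∫ ω in A, (bregman Ψ a (w (k + 1 + N) ω) - r (k + 1)) ∂P ≤
      ∫ ω in A, (bregman Ψ a (w (k + N) ω) - r k) ∂P
    rw [hk, integral_sub (h.integrable_bregman hG (k + N + 1)).restrict (integrable_const _),
      integral_sub (h.integrable_bregman hG (k + N)).restrict (integrable_const _), h3]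
    simp only [integral_const, smul_eq_mul] at h1 ⊢
    linarith
  have hbd : ∀ k, ∫ ω, ‖f k ω‖ ∂P ≤ B + V / σ * ∑' i, η (i + N) ^ 2 := by
    intro k
    have i1 := h.integrable_bregman hG (k + N)
    have h1 := integral_mono (hfint k).norm (i1.add (integrable_const (r k))) fun ω => by
      refine (norm_sub_le _ _).trans (le_of_eq ?_)
      rw [Real.norm_of_nonneg (h.bregman_nonneg _ _), Real.norm_of_nonneg (hr0 k)]
      rfl
    rw [integral_add' i1 (integrable_const _)] at h1
    simp only [integral_const, probReal_univ, one_smul] at h1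
    exact h1.trans (add_le_add (hB _) (hrle k))
  filter_upwards [hsuper.exists_ae_tendsto hbd] with ω ⟨c, hc⟩
  refine ⟨c + V / σ * ∑' i, η (i + N) ^ 2, (tendsto_add_atTop_iff_nat N).1 ?_⟩
  refine (hc.add hr).congr fun k => ?_
  simp [f]

lemma ae_tendsto_norm_sq (h : IsMirrorDescent P ρ G Ψ σ η z w₁ w)
    (hG : IsStochasticGradient ρ G μ L a) (hdiv : ¬ Summable η)
    (hs : Summable fun n => η n ^ 2) :
    ∀ᵐ ω ∂P, Tendsto (fun n => ‖a - w n ω‖ ^ 2) atTop (𝓝 0) := by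
  have hσ := h.sigma_pos
  have hμ := hG.mu_pos
  have hL := hG.L_pos
  have hη : Tendsto η atTop (𝓝 0) := by
    have h1 := hs.tendsto_atTop_zero.sqrt
    rw [Real.sqrt_zero] at h1
    exact h1.congr fun n => Real.sqrt_sq (h.eta_pos n).le
  have hx := h.tendsto_meanBregman_of_tendsto_eta hG hη hdiv
  obtain ⟨B, hB⟩ := hx.bddAbove_range
  have h1 : Tendsto (fun n => η n * L ^ 2 / σ) atTop (𝓝 0) := by
    simpa using (hη.mul_const (L ^ 2)).div_const σ
  obtain ⟨N, hN⟩ := eventually_atTop.1 (h1.eventually (gt_mem_nhds hμ))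
  have hconv := h.exists_ae_tendsto_bregman hG hs ⟨B, fun n => hB ⟨n, rfl⟩⟩
    fun n hn => (hN n hn).le
  filter_upwards [ae_tendsto_zero_of_integral (fun n =>
    (h.stronglyConvex.continuous_bregman_right hσ a).measurable.comp (h.measurable hG n)) (h.integrable_bregman hG)
    (fun n ω => h.bregman_nonneg _ _) hx hconv] with ω hω
  refine squeeze_zero (fun n => sq_nonneg _) (fun n => h.norm_sq_le_bregman n ω) ?_
  simpa using hω.const_mul (2 / σ)

end AlmostSure

end IsMirrorDescent

/-- Shifts time by one, so that the sample z₁ and step η₁ get index 0. -/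
lemma IsOMD.isMirrorDescent {d : ℕ} {𝒳 : Set (W d)} {𝒴 : Set ℝ} {ρ : Measure (𝒳 × 𝒴)}
    {φ : ℝ → ℝ → ℝ} {lam σ : ℝ} {Ψ : W d → ℝ} {η : ℕ → ℝ} {Ω : Type*} [MeasurableSpace Ω]
    {P : Measure Ω} {z : ℕ → Ω → 𝒳 × 𝒴} {w₁ : W d} {w : ℕ → Ω → W d}
    (h : IsOMD φ lam Ψ η z w₁ w) (hz : IsSample ρ P z) (hη : ∀ t, 1 ≤ t → 0 < η t)
    (hΨ : QuadraticallyBounded Ψ) (hσ : 0 < σ) (hΨσ : StronglyConvexWith Ψ σ) :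
    IsMirrorDescent P ρ (regLossGrad φ lam) Ψ σ (fun n => η (n + 1)) (fun n => z (n + 1)) w₁
      (fun n => w (n + 1)) where
  sigma_pos := hσ
  stronglyConvex := hΨσ
  quadraticallyBounded := hΨ
  eta_pos n := hη _ n.succ_pos
  measurable_sample n := (hz.1 _ n.succ_pos).1
  map_sample n := (hz.1 _ n.succ_pos).2
  iIndepFun_sample := hz.2
  init := h.1
  step n := h.2 _ n.succ_pos

end OMD

end

theorem mainTheorem5 {d : ℕ} (𝒳 : Set (OMD.W d)) (𝒴 : Set ℝ)
    (ρ : Measure (𝒳 × 𝒴)) [IsProbabilityMeasure ρ]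
    (φ : ℝ → ℝ → ℝ) (lam : ℝ) (hlam : 0 < lam)
    (hX : BddAbove ((fun x => ‖x‖) '' 𝒳))
    (hφ_meas : Measurable (Function.uncurry φ))
    (hφ_nonneg : ∀ a, ∀ y ∈ 𝒴, 0 ≤ φ a y)
    (hφ_convex : ∀ y ∈ 𝒴, ConvexOn ℝ Set.univ (fun a => φ a y))
    (hφ_diff : ∀ y ∈ 𝒴, Differentiable ℝ (fun a => φ a y))
    (hφ_lip : BddAbove (OMD.lipQuotients φ 𝒴))
    (hF : ∀ w : OMD.W d, Integrable (fun s : 𝒳 × 𝒴 => OMD.regLoss φ lam w s) ρ) :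
    (∀ s : 𝒳 × 𝒴, OMD.StronglySmoothWith (fun w => OMD.regLoss φ lam w s)
      (OMD.smoothConst 𝒳 𝒴 φ lam)) ∧
    OMD.StronglySmoothWith (OMD.risk ρ φ lam) (OMD.smoothConst 𝒳 𝒴 φ lam) ∧
    OMD.StronglyConvexWith (OMD.risk ρ φ lam) (2 * lam) ∧
    ∀ (wstar : OMD.W d), (∀ w, OMD.risk ρ φ lam wstar ≤ OMD.risk ρ φ lam w) →
    ∀ (Ψ : OMD.W d → ℝ), OMD.AdmissibleMirrorMap Ψ →
    (∃ σ : ℝ, 0 < σ ∧ OMD.StronglyConvexWith Ψ σ) ∧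
    ∀ (Ω : Type*) [MeasurableSpace Ω] (P : Measure Ω) [IsProbabilityMeasure P]
      (z : ℕ → Ω → 𝒳 × 𝒴) (η : ℕ → ℝ) (w₁ : OMD.W d) (w : ℕ → Ω → OMD.W d),
      OMD.IsSample ρ P z → (∀ t, 1 ≤ t → 0 < η t) → OMD.IsOMD φ lam Ψ η z w₁ w →
    (∀ t, 1 ≤ t → Integrable (fun ω => ‖wstar - w t ω‖ ^ 2) P) ∧
    -- (a) positive variances
    (0 < (⨅ v : OMD.W d, OMD.meanGradNorm ρ φ lam v) →
      (Tendsto (OMD.meanSqError P wstar w) atTop (𝓝 0) ↔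
        Tendsto η atTop (𝓝 0) ∧ OMD.SumDiverges η) ∧
      (∀ LΨ : ℝ, 0 < LΨ → OMD.StronglySmoothWith Ψ LΨ →
        (Tendsto η atTop (𝓝 0) →
          ∃ T₁ : ℕ, 1 ≤ T₁ ∧ ∃ C : ℝ, 0 < C ∧
            ∀ T : ℕ, T₁ ≤ T → C * (T : ℝ)⁻¹ ≤ OMD.meanSqError P wstar w T) ∧
        ((∀ t : ℕ, 1 ≤ t → η t = 4 / (((t : ℝ) + 1) * (4 * lam / LΨ))) →
          (OMD.meanSqError P wstar w) =O[atTop] (fun T : ℕ => (T : ℝ)⁻¹)))) ∧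
    -- (b) zero variances
    (w₁ ≠ wstar → OMD.meanGradNorm ρ φ lam wstar = 0 →
      ∀ σΨ : ℝ, 0 < σΨ → OMD.StronglyConvexWith Ψ σΨ →
      (∀ κ : ℝ, 0 < κ →
        (∀ t, 1 ≤ t → η t ≤ σΨ / ((2 + κ) * OMD.smoothConst 𝒳 𝒴 φ lam)) →
        (Tendsto (OMD.meanSqError P wstar w) atTop (𝓝 0) ↔ OMD.SumDiverges η)) ∧
      (∀ LΨ : ℝ, 0 < LΨ → OMD.StronglySmoothWith Ψ LΨ →
        (∀ t, 1 ≤ t → η t = η 1) → η 1 < σΨ / (2 * OMD.smoothConst 𝒳 𝒴 φ lam) →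
        ∃ c₁ c₂ : ℝ, 0 < c₁ ∧ c₁ < 1 ∧ 0 < c₂ ∧ c₂ < 1 ∧ ∀ T : ℕ,
          c₁ ^ T * ‖wstar - w₁‖ ^ 2 ≤ OMD.meanSqError P wstar w (T + 1) ∧
          OMD.meanSqError P wstar w (T + 1) ≤ LΨ / σΨ * c₂ ^ T * ‖wstar - w₁‖ ^ 2)) ∧
    -- (c) almost sure convergence
    (OMD.SumDiverges η → Summable (fun t => η t ^ 2) →
      ∀ᵐ ω ∂P, Tendsto (fun t => ‖wstar - w t ω‖ ^ 2) atTop (𝓝 0)) := by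

  have hloss : OMD.IsSmoothLoss 𝒳 𝒴 φ lam :=
    ⟨hlam, hX, hφ_meas, hφ_nonneg, hφ_convex, hφ_diff, hφ_lip⟩
  refine ⟨hloss.stronglySmoothWith_regLoss, hloss.stronglySmoothWith_risk hF,
    hloss.stronglyConvexWith_risk hF, fun wstar hmin Ψ hΨ =>
    ⟨hΨ.exists_stronglyConvexWith, ?_⟩⟩
  intro Ω _ P _ z η w₁ w hz hη hw
  have hG := hloss.isStochasticGradient hF hmin
  have hQ := hΨ.quadraticallyBounded
  -- Any strong convexity constant serves (a) and (c); (b) reruns the reduction with the prescribed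
  -- one, on which its bounds depend.
  obtain ⟨σ, hσ, hΨσ⟩ := hΨ.exists_stronglyConvexWith
  have h := hw.isMirrorDescent hz hη hQ hσ hΨσ
  have hshift : OMD.meanSqError P wstar (fun n => w (n + 1)) =
      fun n => OMD.meanSqError P wstar w (n + 1) := rfl
  have hlim : Tendsto (OMD.meanSqError P wstar w) atTop (𝓝 0) ↔
      Tendsto (OMD.meanSqError P wstar (fun n => w (n + 1))) atTop (𝓝 0) := by
    rw [hshift]
    exact (tendsto_add_atTop_iff_nat 1).symm
  have hlimη : Tendsto η atTop (𝓝 0) ↔ Tendsto (fun n => η (n + 1)) atTop (𝓝 0) :=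
    (tendsto_add_atTop_iff_nat 1).symm
  have hdiv := OMD.sumDiverges_iff hη
  refine ⟨?_, ?_, ?_, ?_⟩
  · intro t ht
    obtain ⟨n, rfl⟩ := Nat.exists_eq_add_of_le' ht
    exact h.integrable_sq hG n
  · intro hpos
    have hm : ∀ v, (⨅ v : OMD.W d, OMD.meanGradNorm ρ φ lam v) ≤
        ∫ s, ‖OMD.regLossGrad φ lam v s‖ ∂ρ := fun v =>
      ciInf_le ⟨0, by rintro _ ⟨v, rfl⟩; exact integral_nonneg fun _ => norm_nonneg _⟩ v
    refine ⟨?_, fun LΨ hL hΨL => ⟨?_, ?_⟩⟩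
    · rw [hlim, hlimη, hdiv]
      exact ⟨fun he => ⟨h.tendsto_eta_of_tendsto_meanSqError hG hpos hm he,
        h.not_summable_of_tendsto_meanSqError hG hpos hm he⟩,
        fun he => h.tendsto_meanSqError hG (h.tendsto_meanBregman_of_tendsto_eta hG he.1 he.2)⟩
    · intro hη0
      obtain ⟨N, hN, C, hC, hle⟩ :=
        h.exists_div_le_meanSqError hG hpos hm hL hΨL (hlimη.1 hη0)
      refine ⟨N + 1, by omega, C, hC, fun T hT => ?_⟩
      obtain ⟨n, rfl⟩ := Nat.exists_eq_add_of_le' (show 1 ≤ T by omega)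
      have hn : N ≤ n := by omega
      have hn0 : (0 : ℝ) < n := by exact_mod_cast (show 0 < n by omega)
      refine le_trans ?_ (hle n hn)
      rw [← div_eq_mul_inv]
      gcongr
      simp
    · intro hη4
      obtain ⟨K, N, hK⟩ := h.exists_meanSqError_le_div hG hL hΨL fun n => by
        rw [hη4 (n + 1) n.succ_pos]
        push_cast
        field_simp
        ring
      refine IsBigO.of_bound K ?_
      filter_upwards [eventually_ge_atTop (N + 1)] with T hT
      obtain ⟨n, rfl⟩ := Nat.exists_eq_add_of_le' (show 1 ≤ T by omega)
      rw [Real.norm_of_nonneg (OMD.meanSqError_nonneg _ _ _ _), Real.norm_of_nonneg (by positivity),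
        ← div_eq_mul_inv]
      push_cast
      exact hK n (by omega)
  · intro hne h0 σΨ hσΨ hΨσΨ
    have h' := hw.isMirrorDescent hz hη hQ hσΨ hΨσΨ
    refine ⟨fun κ hκ hηκ => ?_, fun LΨ hL hΨL hconst hη1 => ?_⟩
    · rw [hlim, hdiv]
      exact h'.tendsto_meanSqError_iff_of_zero hG hne h0 hκ fun n => hηκ _ n.succ_pos
    · exact h'.exists_linear_rate hG hne h0 hL hΨL (fun n => hconst _ n.succ_pos) hη1
  · intro hd hs
    have h1 := h.ae_tendsto_norm_sq hG (hdiv.1 hd)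
      ((summable_nat_add_iff (f := fun t => η t ^ 2) 1).2 hs)
    filter_upwards [h1] with ω hω
    exact (tendsto_add_atTop_iff_nat 1).1 hω
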